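/- Let $k$ be a field; all algebras are associative and unital, and $\otimes=\otimes_k$. A triple $(A,B,\varepsilon)$ consists of a $k$-algebra $A$, a commutative $k$-algebra $B$ and a morphism of $k$-algebras $\varepsilon:B\to A$ with $\varepsilon(B)\subseteq\mathcal Z(A)$. An $A$-bimodule $M$ is $B$-symmetric if $m\varepsilon(\alpha)=\varepsilon(\alpha)m$ for all $m\in M$, $\alpha\in B$. For such $M$, the secondary Hochschild homology $H_\bullet((A,B,\varepsilon);M)$ is the homology of the complex with $C_n=M\otimes A^{\otimes n}\otimes B^{\otimes n(n-1)/2}$, whose elements are spanned by $m\otimes(a_i,b_{i,j})$ with $1\le i\le n$ for the $a_i$ and $1\le i<j\le n$ for the $b_{i,j}$, and whose differential $\partial_n:C_n\to C_{n-1}$ is $\partial_n=\sum_{i=0}^n(-1)^id_i$. Here $d_0$ replaces $m$ by $ma_1\varepsilon(b_{1,2}\cdots b_{1,n})$ and deletes the first row of the array; for $0<i<n$, $d_i$ replaces $a_i,a_{i+1}$ by $a_i\varepsilon(b_{i,i+1})a_{i+1}$ and multiplies the rest of the rows $i,i+1$, and of the columns $i,i+1$, entrywise; and $d_n$ replaces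 $m$ by $a_n\varepsilon(b_{1,n}\cdots b_{n-1,n})m$ and deletes the last column. Two triples $(A,B,\varepsilon)$ and $(A',B',\varepsilon')$ are Morita equivalent as triples if there are an $A$-$A'$-bimodule $P$ and an $A'$-$A$-bimodule $Q$, an isomorphism of $A$-bimodules $P\otimes_{A'}Q\cong A$, an isomorphism of $A'$-bimodules $Q\otimes_AP\cong A'$, and an isomorphism of $k$-algebras $\eta:B\to B'$, such that $\varepsilon(\alpha)p=p\,\varepsilon'(\eta(\alpha))$ and $q\,\varepsilon(\alpha)=\varepsilon'(\eta(\alpha))q$ for all $p\in P$, $q\in Q$, $\alpha\in B$. **Proposition.** Let $(A,B,\varepsilon)$ be a triple and $n\ge1$. Let $I_n(B)$ be the commutative $k$-algebra of scalar matrices $\alpha I_n$, $\alpha\in B$, and let $\varepsilon_*:I_n(B)\to M_n(A)$ be given by $\varepsilon_*(\alpha I_n)=\varepsilon(\alpha)I_n$. Then the triples $(A,B,\varepsilon)$ and $(M_n(A),I_n(B),\varepsilon_*)$ are Morita equivalent as triples. Moreover, for every $B$-symmetric $A$-bimodule $M$ there is, in every degree $i\ge0$, an isomorphism of $k$-vector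 spaces $$H_i((A,B,\varepsilon);M)\cong H_i((M_n(A),I_n(B),\varepsilon_*);M_n(M)),$$ where $M_n(M)$ is an $M_n(A)$-bimodule by matrix multiplication. -/

import Mathlib

open scoped TensorProduct
open MulOpposite

set_option linter.unusedSectionVars false
set_option linter.unusedSimpArgs false

noncomputable section

/-- A triple `(A, B, ε)` over `k`: a `k`-algebra `A`, a commutative `k`-algebra `B` and a morphism
of `k`-algebras `ε : B → A` with image in the center of `A`. -/
structure AlgTriple (k A B : Type*) [CommRing k] [Ring A] [CommRing B] [Algebra k A]
    [Algebra k B] where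
  ε : B →ₐ[k] A
  central : ∀ b : B, ε b ∈ Subalgebra.center k A

namespace AlgTriple

section Chains

variable {k A B : Type*} [CommRing k] [Ring A] [CommRing B] [Algebra k A] [Algebra k B]

/-- Positions strictly above the diagonal of an `n × n` matrix. -/
abbrev Pairs (n : ℕ) : Type := {q : Fin n × Fin n // q.1 < q.2}

variable (k A B) in
/-- The chain module `M ⊗ A^{⊗ n} ⊗ B^{⊗ n(n-1)/2}`, all tensor products over `k`. An element
`m ⊗ (a, b)` is the upper triangular array with diagonal entries `a i` and entries `b (i, j)`,
`i < j`, above the diagonal (indices start at `0`). -/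
abbrev Chain (M : Type*) [AddCommGroup M] [Module k M] (n : ℕ) : Type _ :=
  (M ⊗[k] (⨂[k] _ : Fin n, A)) ⊗[k] (⨂[k] _ : Pairs n, B)

/-- `fiberProd τ b s` is the product of all `b q` over the fiber `τ q = s`. -/
def fiberProd {ι κ : Type*} [Fintype ι] [DecidableEq κ] (τ : ι → κ) (b : ι → B) (s : κ) : B :=
  ∏ q with τ q = s, b q

theorem fiberProd_update {ι κ : Type*} [Fintype ι] [DecidableEq ι] [DecidableEq κ] (τ : ι → κ)
    (b : ι → B) (i : ι) (x : B) :
    fiberProd τ (Function.update b i x) =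
      Function.update (fiberProd τ b) (τ i) (x * ∏ q ∈ Finset.univ.filter (fun q => τ q = τ i) \ {i}, b q) := by
  funext s
  by_cases h : s = τ i
  · subst h
    simp only [fiberProd, Function.update_self]
    rw [Finset.prod_update_of_mem (by simp)]
  · rw [Function.update_of_ne h, fiberProd, fiberProd, Finset.prod_update_of_notMem]
    simpa using fun h' => h h'.symm

variable (k) in
/-- The linear map `⨂_ι B → B ⊗ ⨂_κ B` sending `⨂ b` to the product of the `b q` with `τ q = none`,
tensored with the tensor whose `r`-th factor is the product of the `b q` with `τ q = some r`. -/
def splitB {ι κ : Type*} [Fintype ι] [DecidableEq ι] [DecidableEq κ] (τ : ι → Option κ) :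
    (⨂[k] _ : ι, B) →ₗ[k] B ⊗[k] (⨂[k] _ : κ, B) :=
  PiTensorProduct.lift <| MultilinearMap.mk'
    (fun b => fiberProd τ b none ⊗ₜ[k] PiTensorProduct.tprod k (fun r => fiberProd τ b (some r)))
    (fun b i x y => by
      simp only [fiberProd_update]
      cases h : τ i with
      | none => simp [add_mul, TensorProduct.add_tmul]
      | some r =>
        have key : ∀ z : B, (fun s => Function.update (fiberProd τ b) (some r) z (some s)) =
            Function.update (fun s => fiberProd τ b (some s)) r z := by
          intro z; funext s; simp [Function.update_apply]
        simp [key, add_mul, TensorProduct.tmul_add])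
    (fun b i c x => by
      simp only [fiberProd_update]
      cases h : τ i with
      | none => simp [TensorProduct.smul_tmul']
      | some r =>
        have key : ∀ z : B, (fun s => Function.update (fiberProd τ b) (some r) z (some s)) =
            Function.update (fun s => fiberProd τ b (some s)) r z := by
          intro z; funext s; simp [Function.update_apply]
        simp [key])

@[simp] theorem splitB_tprod {ι κ : Type*} [Fintype ι] [DecidableEq ι] [DecidableEq κ] (τ : ι → Option κ)
    (b : ι → B) : splitB k τ (PiTensorProduct.tprod k b) =
      fiberProd τ b none ⊗ₜ[k] PiTensorProduct.tprod k (fun r => fiberProd τ b (some r)) := by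
  simp [splitB]

/-- Delete the first row: `(0, j)` goes to `none` and `(i + 1, j + 1)` to `(i, j)`. -/
def dropFirst {n : ℕ} (q : Pairs (n + 1)) : Option (Pairs n) :=
  if h : q.1.1 = 0 then none
  else some ⟨(q.1.1.pred h, q.1.2.pred (fun h' => by have := q.2; simp [h'] at this)),
    by simpa using q.2⟩

/-- Delete the last column: `(i, n)` goes to `none`, the other positions stay. -/
def dropLast {n : ℕ} (q : Pairs (n + 1)) : Option (Pairs n) :=
  if h : q.1.2 = Fin.last n then none
  else some ⟨(q.1.1.castPred (fun h' => by have := q.2; rw [h'] at this; exact absurd this (Fin.le_last _).not_gt),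
    q.1.2.castPred h), by simpa using q.2⟩

/-- Merge the rows and columns `p` and `p + 1`: the position `(p, p + 1)` goes to `none` (it ends up
on the diagonal), any other position goes to its image under the monotone surjection identifying
`p` with `p + 1`. -/
def merge {n : ℕ} (p : Fin n) (q : Pairs (n + 1)) : Option (Pairs n) :=
  if h : p.predAbove q.1.1 < p.predAbove q.1.2 then
    some ⟨(p.predAbove q.1.1, p.predAbove q.1.2), h⟩ else none

variable (T : AlgTriple k A B)

/-- The diagonal `(a₀, …, aₚ ε(c) aₚ₊₁, …, aₙ)` obtained by merging the entries `p` and `p + 1`. -/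
def mergeA {n : ℕ} (p : Fin n) (a : Fin (n + 1) → A) (c : B) (j : Fin n) : A :=
  if j < p then a j.castSucc
  else if j = p then a p.castSucc * T.ε c * a p.succ
  else a j.succ

theorem mergeA_eq {n : ℕ} (p : Fin n) (a : Fin (n + 1) → A) (c : B) :
    T.mergeA p a c = Function.update (T.mergeA p a 1) p (a p.castSucc * T.ε c * a p.succ) := by
  funext j
  by_cases h : j = p
  · subst h; simp [mergeA]
  · simp [mergeA, h]

theorem mergeA_update {n : ℕ} (p : Fin n) (a : Fin (n + 1) → A) (c : B) (i : Fin (n + 1)) (x : A) :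
    T.mergeA p (Function.update a i x) c = Function.update (T.mergeA p a c) (p.predAbove i)
      ((if i = p.succ then a p.castSucc * T.ε c else 1) * x *
        (if i = p.castSucc then T.ε c * a p.succ else 1)) := by
  funext j
  have hp : p.castSucc ≠ p.succ := by simp [Fin.ext_iff]
  have hpa : (p.predAbove i).val = if p.val < i.val then i.val - 1 else i.val := by
    simp only [Fin.predAbove, Fin.lt_def, Fin.val_castSucc]; split_ifs <;> simp
  by_cases h1 : i = p.castSucc
  · subst h1
    by_cases hj : j = p
    · subst hj; simp [mergeA, hp, hp.symm, mul_assoc]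
    · rw [Function.update_of_ne (by simpa using hj)]
      have : j.val ≠ p.val := fun h => hj (Fin.ext h)
      simp only [mergeA, hj, if_false]
      split_ifs with h <;> rw [Function.update_of_ne] <;> rw [Fin.lt_def] at h <;>
        simp only [ne_eq, Fin.ext_iff, Fin.val_castSucc, Fin.val_succ] <;> omega
  by_cases h2 : i = p.succ
  · subst h2
    by_cases hj : j = p
    · subst hj; simp [mergeA, hp, hp.symm]
    · rw [Function.update_of_ne (by simpa using hj)]
      have : j.val ≠ p.val := fun h => hj (Fin.ext h)
      simp only [mergeA, hj, if_false]
      split_ifs with h <;> rw [Function.update_of_ne] <;> rw [Fin.lt_def] at h <;>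
        simp only [ne_eq, Fin.ext_iff, Fin.val_castSucc, Fin.val_succ] <;> omega
  simp only [h1, h2, if_false, one_mul, mul_one]
  have h1' : i.val ≠ p.val := fun h => h1 (Fin.ext h)
  have h2' : i.val ≠ p.val + 1 := fun h => h2 (Fin.ext h)
  simp only [mergeA, Function.update_apply, Fin.ext_iff, Fin.lt_def, hpa, Fin.val_castSucc,
    Fin.val_succ]
  split_ifs <;> first | rfl | omega

variable (M : Type*) [AddCommGroup M] [Module k M] [Module A M] [Module Aᵐᵒᵖ M]
  [IsScalarTower k A M] [IsScalarTower k Aᵐᵒᵖ M]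

/-- `m ⊗ a₀ ⊗ ⋯ ⊗ aₙ`, `c` goes to `m a₀ ε(c) ⊗ a₁ ⊗ ⋯ ⊗ aₙ`. -/
def actFirst (n : ℕ) : (M ⊗[k] (⨂[k] _ : Fin (n + 1), A)) →ₗ[k] B →ₗ[k]
    (M ⊗[k] (⨂[k] _ : Fin n, A)) :=
  TensorProduct.lift <| LinearMap.flip <| PiTensorProduct.lift <| MultilinearMap.mk'
    (fun a => LinearMap.mk₂ k
      (fun (m : M) (c : B) => (op (a 0 * T.ε c) • m) ⊗ₜ[k]
        PiTensorProduct.tprod k (fun j : Fin n => a j.succ))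
      (by simp [TensorProduct.add_tmul])
      (by intro c m b; rw [smul_comm, TensorProduct.smul_tmul'])
      (by simp [mul_add, add_smul, TensorProduct.add_tmul])
      (by intro c m b; simp [TensorProduct.smul_tmul']))
    (by
      intro a i x y
      ext m c
      refine Fin.cases ?_ (fun i => ?_) i
      · simp [add_mul, add_smul, TensorProduct.add_tmul]
      · have key : ∀ z : A, (fun j : Fin n => Function.update a i.succ z j.succ) =
            Function.update (fun j : Fin n => a j.succ) i z := by
          intro z; funext j; simp [Function.update_apply]
        have key0 : ∀ z : A, Function.update a i.succ z 0 = a 0 := fun z =>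
          Function.update_of_ne (Fin.succ_ne_zero i).symm _ _
        simp [key, key0, TensorProduct.tmul_add])
    (by
      intro a i r x
      ext m c
      refine Fin.cases ?_ (fun i => ?_) i
      · simp [TensorProduct.smul_tmul']
      · have key : ∀ z : A, (fun j : Fin n => Function.update a i.succ z j.succ) =
            Function.update (fun j : Fin n => a j.succ) i z := by
          intro z; funext j; simp [Function.update_apply]
        have key0 : ∀ z : A, Function.update a i.succ z 0 = a 0 := fun z =>
          Function.update_of_ne (Fin.succ_ne_zero i).symm _ _
        simp [key, key0])

/-- `m ⊗ a₀ ⊗ ⋯ ⊗ aₙ`, `c` goes to `aₙ ε(c) m ⊗ a₀ ⊗ ⋯ ⊗ aₙ₋₁`. -/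
def actLast (n : ℕ) : (M ⊗[k] (⨂[k] _ : Fin (n + 1), A)) →ₗ[k] B →ₗ[k]
    (M ⊗[k] (⨂[k] _ : Fin n, A)) :=
  TensorProduct.lift <| LinearMap.flip <| PiTensorProduct.lift <| MultilinearMap.mk'
    (fun a => LinearMap.mk₂ k
      (fun (m : M) (c : B) => ((a (Fin.last n) * T.ε c) • m) ⊗ₜ[k]
        PiTensorProduct.tprod k (fun j : Fin n => a j.castSucc))
      (by simp [TensorProduct.add_tmul])
      (by intro c m b; rw [smul_comm, TensorProduct.smul_tmul'])
      (by simp [mul_add, add_smul, TensorProduct.add_tmul])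
      (by intro c m b; simp [TensorProduct.smul_tmul']))
    (by
      intro a i x y
      ext m c
      refine Fin.lastCases ?_ (fun i => ?_) i
      · simp [add_mul, add_smul, TensorProduct.add_tmul]
      · have key : ∀ z : A, (fun j : Fin n => Function.update a i.castSucc z j.castSucc) =
            Function.update (fun j : Fin n => a j.castSucc) i z := by
          intro z; funext j; simp [Function.update_apply]
        have key0 : ∀ z : A, Function.update a i.castSucc z (Fin.last n) = a (Fin.last n) :=
          fun z => Function.update_of_ne (Fin.castSucc_lt_last i).ne' _ _
        simp [key, key0, TensorProduct.tmul_add])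
    (by
      intro a i r x
      ext m c
      refine Fin.lastCases ?_ (fun i => ?_) i
      · simp [TensorProduct.smul_tmul']
      · have key : ∀ z : A, (fun j : Fin n => Function.update a i.castSucc z j.castSucc) =
            Function.update (fun j : Fin n => a j.castSucc) i z := by
          intro z; funext j; simp [Function.update_apply]
        have key0 : ∀ z : A, Function.update a i.castSucc z (Fin.last n) = a (Fin.last n) :=
          fun z => Function.update_of_ne (Fin.castSucc_lt_last i).ne' _ _
        simp [key, key0])

/-- `m ⊗ a₀ ⊗ ⋯ ⊗ aₙ`, `c` goes to `m ⊗ a₀ ⊗ ⋯ ⊗ aₚ ε(c) aₚ₊₁ ⊗ ⋯ ⊗ aₙ`. -/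
def actMid {n : ℕ} (p : Fin n) : (M ⊗[k] (⨂[k] _ : Fin (n + 1), A)) →ₗ[k] B →ₗ[k]
    (M ⊗[k] (⨂[k] _ : Fin n, A)) :=
  TensorProduct.lift <| LinearMap.flip <| PiTensorProduct.lift <| MultilinearMap.mk'
    (fun a => LinearMap.mk₂ k
      (fun (m : M) (c : B) => m ⊗ₜ[k] PiTensorProduct.tprod k (T.mergeA p a c))
      (by simp [TensorProduct.add_tmul])
      (by intro c m b; rw [TensorProduct.smul_tmul'])
      (by
        intro m c c'
        rw [T.mergeA_eq p a (c + c'), T.mergeA_eq p a c, T.mergeA_eq p a c']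
        simp [mul_add, add_mul, TensorProduct.tmul_add])
      (by
        intro r m c
        rw [T.mergeA_eq p a (r • c), T.mergeA_eq p a c]
        simp))
    (by
      intro a i x y
      ext m c
      simp only [mergeA_update, mul_add, add_mul]
      simp [TensorProduct.tmul_add])
    (by
      intro a i r x
      ext m c
      simp only [mergeA_update, mul_smul_comm, smul_mul_assoc, MultilinearMap.map_update_smul]
      simp)

/-- Split the entries of `B` by `τ` and let the collected factor act through `act`. -/
def faceOf {n : ℕ} (τ : Pairs (n + 1) → Option (Pairs n))
    (act : (M ⊗[k] (⨂[k] _ : Fin (n + 1), A)) →ₗ[k] B →ₗ[k] (M ⊗[k] (⨂[k] _ : Fin n, A))) :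
    Chain k A B M (n + 1) →ₗ[k] Chain k A B M n :=
  (TensorProduct.lift act).rTensor _ ∘ₗ (TensorProduct.assoc k _ _ _).symm.toLinearMap ∘ₗ
    (splitB k τ).lTensor _

/-- The first face: `m` becomes `m a₀ ε(∏_j b_{0,j})` and the first row is removed. -/
def faceFirst (n : ℕ) : Chain k A B M (n + 1) →ₗ[k] Chain k A B M n :=
  faceOf M dropFirst (T.actFirst M n)

/-- The last face: `m` becomes `aₙ ε(∏_i b_{i,n}) m` and the last column is removed. -/
def faceLast (n : ℕ) : Chain k A B M (n + 1) →ₗ[k] Chain k A B M n :=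
  faceOf M dropLast (T.actLast M n)

/-- The inner face: the rows and columns `p` and `p + 1` are multiplied entrywise, the new diagonal
entry being `aₚ ε(b_{p,p+1}) aₚ₊₁`. -/
def faceMid {n : ℕ} (p : Fin n) : Chain k A B M (n + 1) →ₗ[k] Chain k A B M n :=
  faceOf M (merge p) (T.actMid M p)

/-- The boundary map from degree `n + 1` to degree `n`, the alternating sum of the faces. -/
def boundary (n : ℕ) : Chain k A B M (n + 1) →ₗ[k] Chain k A B M n :=
  T.faceFirst M n + ∑ p : Fin n, (-1 : ℤ) ^ (p.val + 1) • T.faceMid M p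
    + (-1 : ℤ) ^ (n + 1) • T.faceLast M n

variable (k) in
/-- The pure tensor `m ⊗ (a, b)`. -/
def pureChain {M : Type*} [AddCommGroup M] [Module k M] {n : ℕ} (m : M) (a : Fin n → A)
    (b : Pairs n → B) : Chain k A B M n :=
  (m ⊗ₜ[k] PiTensorProduct.tprod k a) ⊗ₜ[k] PiTensorProduct.tprod k b

theorem faceFirst_pure {n : ℕ} (m : M) (a : Fin (n + 1) → A) (b : Pairs (n + 1) → B) :
    T.faceFirst M n (pureChain k m a b) =
      pureChain k (op (a 0 * T.ε (fiberProd dropFirst b none)) • m) (fun j => a j.succ)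
        (fun r => fiberProd dropFirst b (some r)) := by
  simp [faceFirst, faceOf, pureChain, actFirst]

theorem faceLast_pure {n : ℕ} (m : M) (a : Fin (n + 1) → A) (b : Pairs (n + 1) → B) :
    T.faceLast M n (pureChain k m a b) =
      pureChain k ((a (Fin.last n) * T.ε (fiberProd dropLast b none)) • m) (fun j => a j.castSucc)
        (fun r => fiberProd dropLast b (some r)) := by
  simp [faceLast, faceOf, pureChain, actLast]
  rfl

theorem faceMid_pure {n : ℕ} (p : Fin n) (m : M) (a : Fin (n + 1) → A) (b : Pairs (n + 1) → B) :
    T.faceMid M p (pureChain k m a b) =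
      pureChain k m (T.mergeA p a (fiberProd (merge p) b none))
        (fun r => fiberProd (merge p) b (some r)) := by
  simp [faceMid, faceOf, pureChain, actMid]

theorem chain_ext {M N : Type*} [AddCommGroup M] [Module k M] [AddCommGroup N] [Module k N] {n : ℕ}
    {f g : Chain k A B M n →ₗ[k] N} (h : ∀ m a b, f (pureChain k m a b) = g (pureChain k m a b)) : f = g := by
  ext m a b
  exact h m a b

theorem dropFirst_eq_none {n : ℕ} (q : Pairs (n + 1)) : dropFirst q = none ↔ q.1.1.val = 0 := by
  unfold dropFirst
  split_ifs with h
  · simp [h]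
  · simpa using fun h' => h (Fin.ext h')

theorem dropFirst_eq_some {n : ℕ} (q : Pairs (n + 1)) (r : Pairs n) : dropFirst q = some r ↔
    q.1.1.val = r.1.1.val + 1 ∧ q.1.2.val = r.1.2.val + 1 := by
  have h2 := q.2
  have h3 := r.2
  rw [Fin.lt_def] at h2 h3
  unfold dropFirst
  split_ifs with h
  · simp [h]
  · simp only [Option.some.injEq, Subtype.ext_iff, Prod.ext_iff, Fin.ext_iff, Fin.val_pred]
    have : q.1.1.val ≠ 0 := fun h' => h (Fin.ext h')
    omega

theorem dropLast_eq_none {n : ℕ} (q : Pairs (n + 1)) : dropLast q = none ↔ q.1.2.val = n := by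
  unfold dropLast
  split_ifs with h
  · simp [h]
  · simpa using fun h' => h (Fin.ext h')

theorem dropLast_eq_some {n : ℕ} (q : Pairs (n + 1)) (r : Pairs n) : dropLast q = some r ↔
    q.1.1.val = r.1.1.val ∧ q.1.2.val = r.1.2.val := by
  have h2 := q.2
  have h3 := r.2
  rw [Fin.lt_def] at h2 h3
  unfold dropLast
  split_ifs with h
  · have := r.1.2.isLt
    simp [h]; omega
  · simp only [Option.some.injEq, Subtype.ext_iff, Prod.ext_iff, Fin.ext_iff, Fin.coe_castPred]

theorem val_predAbove {n : ℕ} (p : Fin n) (i : Fin (n + 1)) :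
    (p.predAbove i).val = if p.val < i.val then i.val - 1 else i.val := by
  simp only [Fin.predAbove, Fin.lt_def, Fin.val_castSucc]; split_ifs <;> simp

theorem merge_eq_none {n : ℕ} (p : Fin n) (q : Pairs (n + 1)) : merge p q = none ↔
    q.1.1.val = p.val ∧ q.1.2.val = p.val + 1 := by
  have h2 := q.2
  rw [Fin.lt_def] at h2
  simp only [merge, Fin.lt_def, val_predAbove]
  split_ifs <;> simp <;> omega

theorem merge_eq_some {n : ℕ} (p : Fin n) (q : Pairs (n + 1)) (r : Pairs n) : merge p q = some r ↔
    (p.val < q.1.1.val ∧ q.1.1.val = r.1.1.val + 1 ∨ q.1.1.val ≤ p.val ∧ q.1.1.val = r.1.1.val) ∧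
    (p.val < q.1.2.val ∧ q.1.2.val = r.1.2.val + 1 ∨
      q.1.2.val ≤ p.val ∧ q.1.2.val = r.1.2.val) := by
  have h2 := q.2
  have h3 := r.2
  rw [Fin.lt_def] at h2 h3
  unfold merge
  split_ifs with h <;>
    simp only [Option.some.injEq, Subtype.ext_iff, Prod.ext_iff, Fin.ext_iff, val_predAbove,
      Fin.lt_def, reduceCtorEq, false_iff] at * <;> split_ifs at * <;> omega

theorem fiberProd_comp {ι κ μ : Type*} [Fintype ι] [DecidableEq ι] [Fintype κ] [DecidableEq κ]
    [DecidableEq μ] (τ : ι → Option κ) (τ' : κ → Option μ) (b : ι → B) (t : Option μ) :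
    fiberProd τ' (fun r => fiberProd τ b (some r)) t =
      ∏ q with ∃ r, τ q = some r ∧ τ' r = t, b q := by
  simp only [fiberProd]
  rw [← Finset.prod_biUnion]
  · refine Finset.prod_congr ?_ fun _ _ => rfl
    ext q; simp [and_comm]
  · intro x _ y _ hxy
    rw [Function.onFun, Finset.disjoint_left]
    intro q hq hq'
    simp at hq hq'
    exact hxy (Option.some.inj (hq.symm.trans hq'))

theorem fiberProd_comp_some {ι κ κ' μ : Type*} [Fintype ι] [DecidableEq ι] [Fintype κ]
    [DecidableEq κ] [Fintype κ'] [DecidableEq κ'] [DecidableEq μ] {τ : ι → Option κ}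
    {τ' : κ → Option μ} {σ : ι → Option κ'} {σ' : κ' → Option μ} (b : ι → B) 
    (h : ∀ q, (τ q).bind τ' = (σ q).bind σ') (t : μ) :
    fiberProd τ' (fun r => fiberProd τ b (some r)) (some t) =
    fiberProd σ' (fun r => fiberProd σ b (some r)) (some t) := by
  rw [fiberProd_comp, fiberProd_comp]
  refine Finset.prod_congr ?_ fun _ _ => rfl
  ext q
  have := congrArg (fun o => o = some t) (h q)
  simpa [Option.bind_eq_some_iff] using this

theorem fiberProd_comp_none {ι κ μ : Type*} [Fintype ι] [DecidableEq ι] [Fintype κ]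
    [DecidableEq κ] [DecidableEq μ] (τ : ι → Option κ)
    (τ' : κ → Option μ) (b : ι → B) :
    fiberProd τ b none * fiberProd τ' (fun r => fiberProd τ b (some r)) none =
      fiberProd (fun q => (τ q).bind τ') b none := by
  rw [fiberProd_comp, fiberProd, fiberProd, ← Finset.prod_union]
  · refine Finset.prod_congr ?_ fun _ _ => rfl
    ext q
    cases h : τ q <;> simp [h]
  · rw [Finset.disjoint_left]
    intro q hq hq'
    simp at hq hq'
    simp [hq] at hq'

theorem fiberProd_comp_none_eq {ι κ κ' μ : Type*} [Fintype ι] [DecidableEq ι] [Fintype κ]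
    [DecidableEq κ] [Fintype κ'] [DecidableEq κ'] [DecidableEq μ] {τ : ι → Option κ}
    {τ' : κ → Option μ} {σ : ι → Option κ'} {σ' : κ' → Option μ} (b : ι → B)
    (h : ∀ q, (τ q).bind τ' = (σ q).bind σ') :
    fiberProd τ b none * fiberProd τ' (fun r => fiberProd τ b (some r)) none =
    fiberProd σ b none * fiberProd σ' (fun r => fiberProd σ b (some r)) none := by
  rw [fiberProd_comp_none, fiberProd_comp_none, funext h]

theorem fiberProd_comp_none_left {ι κ κ' μ : Type*} [Fintype ι] [DecidableEq ι] [Fintype κ]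
    [DecidableEq κ] [Fintype κ'] [DecidableEq κ'] [DecidableEq μ] {τ : ι → Option κ}
    {τ' : κ → Option μ} {σ : ι → Option κ'} (b : ι → B)
    (h : ∀ q, (∃ r, τ q = some r ∧ τ' r = none) ↔ σ q = none) :
    fiberProd τ' (fun r => fiberProd τ b (some r)) none = fiberProd σ b none := by
  rw [fiberProd_comp]
  refine Finset.prod_congr ?_ fun _ _ => rfl
  ext q
  simp [h q]

theorem bind_first_first {n : ℕ} (q : Pairs (n + 2)) :
    (merge 0 q).bind (dropFirst (n := n)) = (dropFirst q).bind (dropFirst (n := n)) := by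
  have hq := q.2
  rw [Fin.lt_def] at hq
  ext t
  have ht := t.2
  rw [Fin.lt_def] at ht
  rcases h1 : merge 0 q with _ | r <;> rcases h2 : dropFirst q with _ | r' <;>
    simp only [merge_eq_none, merge_eq_some, dropFirst_eq_none, dropFirst_eq_some, dropLast_eq_none,
      dropLast_eq_some, Option.bind_none, Option.bind_some, reduceCtorEq, false_iff, iff_false,
      Option.mem_def, Fin.val_zero, Fin.val_succ, Fin.val_castSucc, Fin.val_last] at * <;>
    omega

theorem bind_first_mid {n : ℕ} (p : Fin n) (q : Pairs (n + 2)) :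
    (merge p.succ q).bind (dropFirst (n := n)) = (dropFirst q).bind (merge p) := by
  have hq := q.2
  rw [Fin.lt_def] at hq
  ext t
  have ht := t.2
  rw [Fin.lt_def] at ht
  rcases h1 : merge p.succ q with _ | r <;> rcases h2 : dropFirst q with _ | r' <;>
    simp only [merge_eq_none, merge_eq_some, dropFirst_eq_none, dropFirst_eq_some, dropLast_eq_none,
      dropLast_eq_some, Option.bind_none, Option.bind_some, reduceCtorEq, false_iff, iff_false,
      Option.mem_def, Fin.val_zero, Fin.val_succ, Fin.val_castSucc, Fin.val_last] at * <;>
    omega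

theorem bind_first_last {n : ℕ} (q : Pairs (n + 2)) :
    (dropLast q).bind (dropFirst (n := n)) = (dropFirst q).bind (dropLast (n := n)) := by
  have hq := q.2
  rw [Fin.lt_def] at hq
  ext t
  have ht := t.2
  rw [Fin.lt_def] at ht
  rcases h1 : dropLast q with _ | r <;> rcases h2 : dropFirst q with _ | r' <;>
    simp only [merge_eq_none, merge_eq_some, dropFirst_eq_none, dropFirst_eq_some, dropLast_eq_none,
      dropLast_eq_some, Option.bind_none, Option.bind_some, reduceCtorEq, false_iff, iff_false,
      Option.mem_def, Fin.val_zero, Fin.val_succ, Fin.val_castSucc, Fin.val_last] at * <;>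
    omega

theorem bind_mid_mid {n : ℕ} (p p' : Fin n) (hp : p.val ≤ p'.val) (q : Pairs (n + 2)) :
    (merge p'.succ q).bind (merge p) = (merge p.castSucc q).bind (merge p') := by
  have hq := q.2
  rw [Fin.lt_def] at hq
  ext t
  have ht := t.2
  rw [Fin.lt_def] at ht
  rcases h1 : merge p'.succ q with _ | r <;> rcases h2 : merge p.castSucc q with _ | r' <;>
    simp only [merge_eq_none, merge_eq_some, dropFirst_eq_none, dropFirst_eq_some, dropLast_eq_none,
      dropLast_eq_some, Option.bind_none, Option.bind_some, reduceCtorEq, false_iff, iff_false,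
      Option.mem_def, Fin.val_zero, Fin.val_succ, Fin.val_castSucc, Fin.val_last] at * <;>
    omega

theorem bind_mid_last {n : ℕ} (p : Fin n) (q : Pairs (n + 2)) :
    (dropLast q).bind (merge p) = (merge p.castSucc q).bind (dropLast (n := n)) := by
  have hq := q.2
  rw [Fin.lt_def] at hq
  ext t
  have ht := t.2
  rw [Fin.lt_def] at ht
  rcases h1 : dropLast q with _ | r <;> rcases h2 : merge p.castSucc q with _ | r' <;>
    simp only [merge_eq_none, merge_eq_some, dropFirst_eq_none, dropFirst_eq_some, dropLast_eq_none,
      dropLast_eq_some, Option.bind_none, Option.bind_some, reduceCtorEq, false_iff, iff_false,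
      Option.mem_def, Fin.val_zero, Fin.val_succ, Fin.val_castSucc, Fin.val_last] at * <;>
    omega

theorem bind_last_last {n : ℕ} (q : Pairs (n + 2)) :
    (dropLast q).bind (dropLast (n := n)) = (merge (Fin.last n) q).bind (dropLast (n := n)) := by
  have hq := q.2
  rw [Fin.lt_def] at hq
  ext t
  have ht := t.2
  rw [Fin.lt_def] at ht
  rcases h1 : dropLast q with _ | r <;> rcases h2 : merge (Fin.last n) q with _ | r' <;>
    simp only [merge_eq_none, merge_eq_some, dropFirst_eq_none, dropFirst_eq_some, dropLast_eq_none,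
      dropLast_eq_some, Option.bind_none, Option.bind_some, reduceCtorEq, false_iff, iff_false,
      Option.mem_def, Fin.val_zero, Fin.val_succ, Fin.val_castSucc, Fin.val_last] at * <;>
    omega

theorem none_first_mid {n : ℕ} (p : Fin n) (q : Pairs (n + 2)) :
    (∃ r, merge p.succ q = some r ∧ dropFirst (n := n) r = none) ↔ dropFirst q = none := by
  have hq := q.2
  rw [Fin.lt_def] at hq
  rcases h1 : merge p.succ q with _ | r <;>
    simp only [merge_eq_none, merge_eq_some, dropFirst_eq_none, dropFirst_eq_some, dropLast_eq_none,
      dropLast_eq_some, reduceCtorEq, false_iff, iff_false, false_and, exists_false, Option.some.injEq,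
      exists_eq_left', Fin.val_zero, Fin.val_succ, Fin.val_castSucc, Fin.val_last] at * <;>
    omega

theorem none_first_mid' {n : ℕ} (p : Fin n) (q : Pairs (n + 2)) :
    (∃ r, dropFirst q = some r ∧ merge p r = none) ↔ merge p.succ q = none := by
  have hq := q.2
  rw [Fin.lt_def] at hq
  rcases h1 : dropFirst q with _ | r <;>
    simp only [merge_eq_none, merge_eq_some, dropFirst_eq_none, dropFirst_eq_some, dropLast_eq_none,
      dropLast_eq_some, reduceCtorEq, false_iff, iff_false, false_and, exists_false, Option.some.injEq,
      exists_eq_left', Fin.val_zero, Fin.val_succ, Fin.val_castSucc, Fin.val_last] at * <;>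
    omega

theorem none_mid_last {n : ℕ} (p : Fin n) (q : Pairs (n + 2)) :
    (∃ r, dropLast q = some r ∧ merge p r = none) ↔ merge p.castSucc q = none := by
  have hq := q.2
  rw [Fin.lt_def] at hq
  rcases h1 : dropLast q with _ | r <;>
    simp only [merge_eq_none, merge_eq_some, dropFirst_eq_none, dropFirst_eq_some, dropLast_eq_none,
      dropLast_eq_some, reduceCtorEq, false_iff, iff_false, false_and, exists_false, Option.some.injEq,
      exists_eq_left', Fin.val_zero, Fin.val_succ, Fin.val_castSucc, Fin.val_last] at * <;>
    omega

theorem none_mid_last' {n : ℕ} (p : Fin n) (q : Pairs (n + 2)) :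
    (∃ r, merge p.castSucc q = some r ∧ dropLast (n := n) r = none) ↔ dropLast q = none := by
  have hq := q.2
  rw [Fin.lt_def] at hq
  rcases h1 : merge p.castSucc q with _ | r <;>
    simp only [merge_eq_none, merge_eq_some, dropFirst_eq_none, dropFirst_eq_some, dropLast_eq_none,
      dropLast_eq_some, reduceCtorEq, false_iff, iff_false, false_and, exists_false, Option.some.injEq,
      exists_eq_left', Fin.val_zero, Fin.val_succ, Fin.val_castSucc, Fin.val_last] at * <;>
    omega

theorem none_mid_mid {n : ℕ} (p p' : Fin n) (hp : p.val < p'.val) (q : Pairs (n + 2)) :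
    (∃ r, merge p'.succ q = some r ∧ merge p r = none) ↔ merge p.castSucc q = none := by
  have hq := q.2
  rw [Fin.lt_def] at hq
  rcases h1 : merge p'.succ q with _ | r <;>
    simp only [merge_eq_none, merge_eq_some, dropFirst_eq_none, dropFirst_eq_some, dropLast_eq_none,
      dropLast_eq_some, reduceCtorEq, false_iff, iff_false, false_and, exists_false, Option.some.injEq,
      exists_eq_left', Fin.val_zero, Fin.val_succ, Fin.val_castSucc, Fin.val_last] at * <;>
    omega

theorem none_mid_mid' {n : ℕ} (p p' : Fin n) (hp : p.val < p'.val) (q : Pairs (n + 2)) :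
    (∃ r, merge p.castSucc q = some r ∧ merge p' r = none) ↔ merge p'.succ q = none := by
  have hq := q.2
  rw [Fin.lt_def] at hq
  rcases h1 : merge p.castSucc q with _ | r <;>
    simp only [merge_eq_none, merge_eq_some, dropFirst_eq_none, dropFirst_eq_some, dropLast_eq_none,
      dropLast_eq_some, reduceCtorEq, false_iff, iff_false, false_and, exists_false, Option.some.injEq,
      exists_eq_left', Fin.val_zero, Fin.val_succ, Fin.val_castSucc, Fin.val_last] at * <;>
    omega

/-- The `A`-bimodule `M` is `B`-symmetric: `m ε(b) = ε(b) m` for all `b` and `m`. -/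
def IsSymmetric (M : Type*) [AddCommGroup M] [Module A M] [Module Aᵐᵒᵖ M] : Prop :=
  ∀ (b : B) (m : M), op (T.ε b) • m = T.ε b • m

theorem comm (b : B) (x : A) : T.ε b * x = x * T.ε b :=
  (Subalgebra.mem_center_iff.mp (T.central b) x).symm

theorem mul_ε_mul (x y : A) (b : B) : x * T.ε b * y = x * y * T.ε b := by
  rw [mul_assoc, T.comm, mul_assoc]

theorem collect (x y : A) (u v : B) : x * T.ε u * (y * T.ε v) = x * y * T.ε (u * v) := by
  rw [← mul_assoc, mul_ε_mul, mul_assoc, map_mul]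

theorem collect' (x y z : A) (u v : B) :
    x * T.ε u * (y * T.ε v * z) = x * y * z * T.ε (u * v) := by
  rw [T.mul_ε_mul y, T.collect, ← mul_assoc]

theorem collect'' (x y z : A) (u v : B) :
    x * T.ε u * y * T.ε v * z = x * y * z * T.ε (u * v) := by
  rw [mul_assoc x, T.comm u, ← mul_assoc, mul_assoc (x * y), ← map_mul, T.mul_ε_mul]

theorem pure_congr {M : Type*} [AddCommGroup M] [Module k M] {n : ℕ} {m m' : M} {a a' : Fin n → A}
    {b b' : Pairs n → B} (hm : m = m') (ha : a = a') (hb : b = b') :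
    pureChain k m a b = pureChain k m' a' b' := by rw [hm, ha, hb]

theorem mergeA_of_lt {n : ℕ} {p j : Fin n} (a : Fin (n + 1) → A) (c : B) (h : j.val < p.val) :
    T.mergeA p a c j = a j.castSucc := by
  simp [mergeA, Fin.lt_def, h]

theorem mergeA_self {n : ℕ} (p : Fin n) (a : Fin (n + 1) → A) (c : B) :
    T.mergeA p a c p = a p.castSucc * T.ε c * a p.succ := by
  simp [mergeA]

theorem mergeA_of_gt {n : ℕ} {p j : Fin n} (a : Fin (n + 1) → A) (c : B) (h : p.val < j.val) :
    T.mergeA p a c j = a j.succ := by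
  have h1 : ¬ j.val < p.val := by omega
  have h2 : ¬ j.val = p.val := by omega
  simp [mergeA, Fin.lt_def, Fin.ext_iff, h1, h2]

theorem first_first (n : ℕ) :
    T.faceFirst M n ∘ₗ T.faceMid M 0 = T.faceFirst M n ∘ₗ T.faceFirst M (n + 1) := by
  refine chain_ext fun m a b => ?_
  simp only [LinearMap.comp_apply, faceFirst_pure, faceMid_pure]
  refine pure_congr ?_ ?_ ?_
  · rw [smul_smul, ← op_mul]
    congr 2
    rw [T.collect, ← fiberProd_comp_none_eq b (bind_first_first (n := n)), mergeA_self, mul_ε_mul,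
      mul_assoc, ← map_mul]
    rfl
  · funext j
    exact T.mergeA_of_gt _ _ (by simp)
  · funext t
    exact fiberProd_comp_some b bind_first_first t

theorem first_mid {n : ℕ} (p : Fin n) :
    T.faceFirst M n ∘ₗ T.faceMid M p.succ = T.faceMid M p ∘ₗ T.faceFirst M (n + 1) := by
  refine chain_ext fun m a b => ?_
  simp only [LinearMap.comp_apply, faceFirst_pure, faceMid_pure]
  refine pure_congr ?_ ?_ ?_
  · rw [fiberProd_comp_none_left b (none_first_mid p), T.mergeA_of_lt _ _ (by simp)]
    rfl
  · rw [fiberProd_comp_none_left b (none_first_mid' p)]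
    funext j
    rcases lt_trichotomy j.val p.val with h | h | h
    · rw [T.mergeA_of_lt _ _ h, T.mergeA_of_lt _ _ (by simpa using h)]; rfl
    · obtain rfl := Fin.ext h
      rw [T.mergeA_self, T.mergeA_self]; rfl
    · rw [T.mergeA_of_gt _ _ h, T.mergeA_of_gt _ _ (by simpa using h)]
  · funext t
    exact fiberProd_comp_some b (bind_first_mid p) t

theorem first_last [SMulCommClass A Aᵐᵒᵖ M] (hM : T.IsSymmetric M) (n : ℕ) :
    T.faceFirst M n ∘ₗ T.faceLast M (n + 1) = T.faceLast M n ∘ₗ T.faceFirst M (n + 1) := by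
  refine chain_ext fun m a b => ?_
  simp only [LinearMap.comp_apply, faceFirst_pure, faceLast_pure]
  refine pure_congr ?_ rfl ?_
  · have key : ∀ (x y : A) (u v : B), op (x * T.ε v) • (y * T.ε u) • m =
        (y * T.ε (u * v)) • op x • m := by
      intro x y u v
      rw [op_mul, mul_smul, hM, ← smul_comm (_ : A) (op x), smul_smul, T.comm, mul_assoc, ← map_mul]
    have key' : ∀ (x y : A) (u v : B), (y * T.ε v) • op (x * T.ε u) • m =
        (y * T.ε (u * v)) • op x • m := by
      intro x y u v
      rw [op_mul, mul_smul (op (T.ε u)), hM, smul_smul, mul_assoc, ← map_mul, mul_comm v]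
    rw [key, key', fiberProd_comp_none_eq b (bind_first_last (n := n))]
    rfl
  · funext t
    exact fiberProd_comp_some b bind_first_last t

theorem mid_mid {n : ℕ} (p p' : Fin n) (hp : p.val ≤ p'.val) :
    T.faceMid M p ∘ₗ T.faceMid M p'.succ = T.faceMid M p' ∘ₗ T.faceMid M p.castSucc := by
  refine chain_ext fun m a b => ?_
  simp only [LinearMap.comp_apply, faceMid_pure]
  refine pure_congr rfl ?_ ?_
  · rcases hp.lt_or_eq with hp' | hp'
    · rw [fiberProd_comp_none_left b (none_mid_mid p p' hp'),
        fiberProd_comp_none_left b (none_mid_mid' p p' hp')]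
      generalize fiberProd (merge p.castSucc) b none = c
      generalize fiberProd (merge p'.succ) b none = c'
      funext j
      rcases lt_trichotomy j.val p.val with h | h | h
      · rw [T.mergeA_of_lt _ _ h, T.mergeA_of_lt _ _ (by simp; omega),
          T.mergeA_of_lt _ _ (by omega), T.mergeA_of_lt _ _ (by simpa using h)]
      · obtain rfl := Fin.ext h
        rw [T.mergeA_self, T.mergeA_of_lt _ _ (by simp; omega), T.mergeA_of_lt _ _ (by simp; omega),
          T.mergeA_of_lt _ _ (by omega), T.mergeA_self]
        rfl
      rw [T.mergeA_of_gt _ _ h]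
      rcases lt_trichotomy j.val p'.val with h' | h' | h'
      · rw [T.mergeA_of_lt _ _ (by simpa using h'), T.mergeA_of_lt _ _ (by omega),
          T.mergeA_of_gt _ _ (by simpa using h)]
        rfl
      · obtain rfl := Fin.ext h'
        rw [T.mergeA_self, T.mergeA_self, T.mergeA_of_gt _ _ (by simpa using h),
          T.mergeA_of_gt _ _ (by simp; omega)]
        rfl
      · rw [T.mergeA_of_gt _ _ (by simpa using h'), T.mergeA_of_gt _ _ h',
          T.mergeA_of_gt _ _ (by simp; omega)]
    · obtain rfl := Fin.ext hp'
      funext j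
      rcases lt_trichotomy j.val p.val with h | h | h
      · rw [T.mergeA_of_lt _ _ h, T.mergeA_of_lt _ _ (by simp; omega),
          T.mergeA_of_lt _ _ (by omega), T.mergeA_of_lt _ _ (by simpa using h)]
      · obtain rfl := Fin.ext h
        rw [T.mergeA_self, T.mergeA_self, T.mergeA_self, T.mergeA_self,
          T.mergeA_of_lt _ _ (by simp), T.mergeA_of_gt _ _ (by simp)]
        rw [T.collect', T.collect'', mul_comm, fiberProd_comp_none_eq b (bind_mid_mid j j le_rfl)]
        rfl
      · rw [T.mergeA_of_gt _ _ h, T.mergeA_of_gt _ _ (by simpa using h), T.mergeA_of_gt _ _ h,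
          T.mergeA_of_gt _ _ (by simp; omega)]
  · funext t
    exact fiberProd_comp_some b (bind_mid_mid p p' hp) t

theorem mid_last {n : ℕ} (p : Fin n) :
    T.faceMid M p ∘ₗ T.faceLast M (n + 1) = T.faceLast M n ∘ₗ T.faceMid M p.castSucc := by
  refine chain_ext fun m a b => ?_
  simp only [LinearMap.comp_apply, faceLast_pure, faceMid_pure]
  refine pure_congr ?_ ?_ ?_
  · rw [fiberProd_comp_none_left b (none_mid_last' p), T.mergeA_of_gt _ _ (by simp)]
    rfl
  · rw [fiberProd_comp_none_left b (none_mid_last p)]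
    funext j
    rcases lt_trichotomy j.val p.val with h | h | h
    · rw [T.mergeA_of_lt _ _ h, T.mergeA_of_lt _ _ (by simpa using h)]
    · obtain rfl := Fin.ext h
      rw [T.mergeA_self, T.mergeA_self]; rfl
    · rw [T.mergeA_of_gt _ _ h, T.mergeA_of_gt _ _ (by simpa using h)]; rfl
  · funext t
    exact fiberProd_comp_some b (bind_mid_last p) t

theorem last_last (n : ℕ) :
    T.faceLast M n ∘ₗ T.faceLast M (n + 1) = T.faceLast M n ∘ₗ T.faceMid M (Fin.last n) := by
  refine chain_ext fun m a b => ?_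
  simp only [LinearMap.comp_apply, faceLast_pure, faceMid_pure]
  refine pure_congr ?_ ?_ ?_
  · rw [smul_smul]
    congr 1
    rw [T.collect, mergeA_self, mul_ε_mul, mul_assoc _ (T.ε _) (T.ε _), ← map_mul, mul_comm (fiberProd dropLast _ _),
      fiberProd_comp_none_eq b (bind_last_last (n := n))]
    rfl
  · funext j
    exact (T.mergeA_of_lt _ _ (by simp)).symm
  · funext t
    exact fiberProd_comp_some b bind_last_last t

theorem alternating_sum_comp {X Y Z : Type*} [AddCommGroup X] [AddCommGroup Y] [AddCommGroup Z]
    [Module k X] [Module k Y] [Module k Z] {n : ℕ} (f : Fin (n + 2) → Y →ₗ[k] Z)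
    (g : Fin (n + 3) → X →ₗ[k] Y)
    (h : ∀ i j : Fin (n + 2), i ≤ j → f i ∘ₗ g j.succ = f j ∘ₗ g i.castSucc) :
    (∑ i : Fin (n + 2), (-1 : ℤ) ^ i.val • f i) ∘ₗ (∑ i : Fin (n + 3), (-1 : ℤ) ^ i.val • g i)
      = 0 := by
  have key : (∑ i : Fin (n + 2), (-1 : ℤ) ^ i.val • f i) ∘ₗ
      (∑ i : Fin (n + 3), (-1 : ℤ) ^ i.val • g i) = ∑ i : Fin (n + 2), ∑ j : Fin (n + 3),
      ((-1 : ℤ) ^ i.val * (-1 : ℤ) ^ j.val) • (f i ∘ₗ g j) := by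
    refine LinearMap.ext fun x => ?_
    simp only [LinearMap.comp_apply, LinearMap.sum_apply, LinearMap.smul_apply,
      map_sum, map_zsmul, Finset.smul_sum, mul_smul]
    rw [Finset.sum_comm]
    exact Finset.sum_congr rfl fun i _ => Finset.sum_congr rfl fun j _ => smul_comm _ _ _
  rw [key, ← Finset.sum_product']
  let P := Fin (n + 2) × Fin (n + 3)
  let S : Finset P := {ij : P | (ij.2 : ℕ) ≤ (ij.1 : ℕ)}
  rw [Finset.univ_product_univ, ← Finset.sum_add_sum_compl S, ← eq_neg_iff_add_eq_zero,
    ← Finset.sum_neg_distrib]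
  let φ : ∀ ij : P, ij ∈ S → P := fun ij hij =>
    (Fin.castLT ij.2 (lt_of_le_of_lt (Finset.mem_filter.mp hij).right (Fin.is_lt ij.1)), ij.1.succ)
  apply Finset.sum_bij φ
  · intro ij hij
    simp_rw [S, φ, Finset.compl_filter, Finset.mem_filter_univ, Fin.val_succ,
      Fin.val_castLT] at hij ⊢
    lia
  · rintro ⟨i, j⟩ hij ⟨i', j'⟩ hij' h'
    rw [Prod.mk_inj]
    exact ⟨by simpa [φ] using! congr_arg Prod.snd h',
      by simpa [φ, Fin.castSucc_castLT] using! congr_arg Fin.castSucc (congr_arg Prod.fst h')⟩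
  · rintro ⟨i', j'⟩ hij'
    simp_rw [S, Finset.compl_filter, Finset.mem_filter_univ, not_le] at hij'
    refine ⟨(j'.pred <| ?_, Fin.castSucc i'), ?_, ?_⟩
    · rintro rfl
      simp only [Fin.val_zero, not_lt_zero] at hij'
    · simpa [S] using! Nat.le_sub_one_of_lt hij'
    · simp only [φ, Fin.castLT_castSucc, Fin.succ_pred]
  · rintro ⟨i, j⟩ hij
    have hij' : j.val ≤ i.val := by simpa [S] using hij
    have := h (Fin.castLT j (by omega)) i (by simpa [Fin.le_def] using hij')
    rw [Fin.castSucc_castLT] at this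
    simp only [φ, this, ← neg_smul]
    congr 1
    simp only [Fin.val_succ, Fin.val_castLT, pow_succ]
    ring

/-- The faces `d₀, …, dₙ₊₁`. -/
def face (n : ℕ) (i : Fin (n + 2)) : Chain k A B M (n + 1) →ₗ[k] Chain k A B M n :=
  Fin.cases (T.faceFirst M n)
    (fun j => Fin.lastCases (T.faceLast M n) (fun p => T.faceMid M p) j) i

theorem face_zero (n : ℕ) : T.face M n 0 = T.faceFirst M n := rfl

theorem face_mid {n : ℕ} (p : Fin n) : T.face M n p.castSucc.succ = T.faceMid M p := by
  simp [face]

theorem face_last (n : ℕ) : T.face M n (Fin.last n).succ = T.faceLast M n := by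
  simp only [face, Fin.cases_succ, Fin.lastCases_last]

theorem boundary_eq (n : ℕ) :
    T.boundary M n = ∑ i : Fin (n + 2), (-1 : ℤ) ^ i.val • T.face M n i := by
  rw [Fin.sum_univ_succ, Fin.sum_univ_castSucc]
  simp only [face_mid, face_last, face_zero, boundary, add_assoc]
  simp

theorem face_comp_face [SMulCommClass A Aᵐᵒᵖ M] (hM : T.IsSymmetric M) (n : ℕ) (i j : Fin (n + 2))
    (h : i ≤ j) :
    T.face M n i ∘ₗ T.face M (n + 1) j.succ = T.face M n j ∘ₗ T.face M (n + 1) i.castSucc := by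
  rw [Fin.le_def] at h
  induction j using Fin.cases with
  | zero =>
    obtain rfl : i = 0 := Fin.ext (by simpa using h)
    exact (T.face_mid M (n := n + 1) 0) ▸ T.first_first M n
  | succ j =>
    induction i using Fin.cases with
    | zero =>
      induction j using Fin.lastCases with
      | last =>
        rw [face_last, Fin.castSucc_zero, face_zero, face_zero,
          show T.face M (n + 1) (Fin.last n).succ.succ = T.faceLast M (n + 1) from
            T.face_last M (n + 1)]
        exact T.first_last M hM n
      | cast j =>
        rw [face_mid, Fin.castSucc_zero, face_zero, face_zero, Fin.succ_castSucc, face_mid]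
        exact T.first_mid M j
    | succ i =>
      induction j using Fin.lastCases with
      | last =>
        rw [face_last, ← Fin.succ_castSucc, face_mid,
          show T.face M (n + 1) (Fin.last n).succ.succ = T.faceLast M (n + 1) from
            T.face_last M (n + 1)]
        induction i using Fin.lastCases with
        | last => rw [face_last]; exact T.last_last M n
        | cast i => rw [face_mid]; exact T.mid_last M i
      | cast j =>
        induction i using Fin.lastCases with
        | last => simp at h; omega
        | cast i =>
          rw [face_mid, face_mid, Fin.succ_castSucc, face_mid, ← Fin.succ_castSucc, face_mid]
          exact T.mid_mid M i j (by simpa using h)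

theorem boundary_comp_boundary [SMulCommClass A Aᵐᵒᵖ M] (hM : T.IsSymmetric M) (n : ℕ) :
    T.boundary M n ∘ₗ T.boundary M (n + 1) = 0 := by
  rw [boundary_eq, boundary_eq]
  exact alternating_sum_comp _ _ (T.face_comp_face M hM n)

/-- The secondary Hochschild complex of `(A, B, ε)` with coefficients in `M`. -/
def complex [SMulCommClass A Aᵐᵒᵖ M] (hM : T.IsSymmetric M) : ChainComplex (ModuleCat k) ℕ :=
  ChainComplex.of (fun n => ModuleCat.of k (Chain k A B M n))
    (fun n => ModuleCat.ofHom (T.boundary M n))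
    (fun n => by rw [← ModuleCat.ofHom_comp, T.boundary_comp_boundary M hM n]; rfl)

/-- The secondary Hochschild homology of the triple `(A, B, ε)` with coefficients in the
`B`-symmetric `A`-bimodule `M`, in degree `i`. -/
def homology [SMulCommClass A Aᵐᵒᵖ M] (hM : T.IsSymmetric M) (i : ℕ) : ModuleCat k :=
  (T.complex M hM).homology i

end Chains
end AlgTriple

/-- The tensor product `X ⊗_R Y` of a right `R`-module `X` and a left `R`-module `Y` over a possibly
noncommutative ring `R`: the quotient of `X ⊗_ℤ Y` by the relations `x r ⊗ y = x ⊗ r y`. -/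
def BalancedTensor (R X Y : Type*) [Ring R] [AddCommGroup X] [AddCommGroup Y] [Module Rᵐᵒᵖ X]
    [Module R Y] : Type _ :=
  (X ⊗[ℤ] Y) ⧸ AddSubgroup.closure
    {z : X ⊗[ℤ] Y | ∃ (x : X) (r : R) (y : Y), z = (op r • x) ⊗ₜ[ℤ] y - x ⊗ₜ[ℤ] (r • y)}

namespace BalancedTensor

section

variable (R X Y : Type*) [Ring R] [AddCommGroup X] [AddCommGroup Y] [Module Rᵐᵒᵖ X] [Module R Y]

instance : AddCommGroup (BalancedTensor R X Y) :=
  inferInstanceAs (AddCommGroup ((X ⊗[ℤ] Y) ⧸ AddSubgroup.closure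
    {z : X ⊗[ℤ] Y | ∃ (x : X) (r : R) (y : Y), z = (op r • x) ⊗ₜ[ℤ] y - x ⊗ₜ[ℤ] (r • y)}))

variable {X Y}

/-- The class of `x ⊗ y`. -/
def tmul (x : X) (y : Y) : BalancedTensor R X Y := QuotientAddGroup.mk (x ⊗ₜ[ℤ] y)

variable {R}

/-- The additive map `x ⊗ y ↦ φ x ⊗ ψ y`. -/
def map (φ : X →+ X) (ψ : Y →+ Y) (hφ : ∀ (r : R) x, φ (op r • x) = op r • φ x)
    (hψ : ∀ (r : R) y, ψ (r • y) = r • ψ y) : BalancedTensor R X Y →+ BalancedTensor R X Y :=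
  QuotientAddGroup.map _ _
    (TensorProduct.map φ.toIntLinearMap ψ.toIntLinearMap).toAddMonoidHom (by
      rw [AddSubgroup.closure_le]
      rintro _ ⟨x, r, y, rfl⟩
      refine AddSubgroup.subset_closure ⟨φ x, r, ψ y, ?_⟩
      simp [hφ, hψ])

/-- The left action `s (x ⊗ y) = (s x) ⊗ y` when `X` is an `S`-`R`-bimodule. -/
def leftAct {S : Type*} [Ring S] [Module S X] [SMulCommClass S Rᵐᵒᵖ X] (s : S) :
    BalancedTensor R X Y →+ BalancedTensor R X Y :=
  map (DistribSMul.toAddMonoidHom X s) (AddMonoidHom.id Y) (fun r x => smul_comm s (op r) x)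
    (fun _ _ => rfl)

/-- The right action `(x ⊗ y) s = x ⊗ (y s)` when `Y` is an `R`-`S`-bimodule. -/
def rightAct {S : Type*} [Ring S] [Module Sᵐᵒᵖ Y] [SMulCommClass R Sᵐᵒᵖ Y] (s : S) :
    BalancedTensor R X Y →+ BalancedTensor R X Y :=
  map (AddMonoidHom.id X) (DistribSMul.toAddMonoidHom Y (op s)) (fun _ _ => rfl)
    (fun r y => (smul_comm r (op s) y).symm)

theorem leftAct_tmul {S : Type*} [Ring S] [Module S X] [SMulCommClass S Rᵐᵒᵖ X] (s : S) (x : X)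
    (y : Y) : leftAct s (tmul R x y) = tmul R (s • x) y := rfl

theorem rightAct_tmul {S : Type*} [Ring S] [Module Sᵐᵒᵖ Y] [SMulCommClass R Sᵐᵒᵖ Y] (s : S) (x : X)
    (y : Y) : rightAct s (tmul R x y) = tmul R x (op s • y) := rfl

theorem smul_tmul (r : R) (x : X) (y : Y) : tmul R (op r • x) y = tmul R x (r • y) := by
  refine (QuotientAddGroup.eq_iff_sub_mem).mpr ?_
  exact AddSubgroup.subset_closure ⟨x, r, y, rfl⟩

end

end BalancedTensor

universe u v w v' w'

/-- The data `(P, Q, f, g, η)` of a Morita equivalence of triples between `(A, B, ε)` and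
`(A', B', ε')`: an `A`-`A'`-bimodule `P`, an `A'`-`A`-bimodule `Q`, an isomorphism of `A`-bimodules
`f : P ⊗_{A'} Q ≅ A`, an isomorphism of `A'`-bimodules `g : Q ⊗_A P ≅ A'` and an isomorphism of
`k`-algebras `η : B ≅ B'` such that `ε(α) p = p ε'(η(α))` and `q ε(α) = ε'(η(α)) q`. Taking `α` in
the image of `k`, one sees that `k` acts in the same way from both sides on `P` and on `Q`. -/
structure MoritaContext {k : Type u} {A : Type v} {B : Type w} {A' : Type v'} {B' : Type w'}
    [CommRing k] [Ring A] [CommRing B] [Algebra k A] [Algebra k B]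
    [Ring A'] [CommRing B'] [Algebra k A'] [Algebra k B']
    (T : AlgTriple k A B) (T' : AlgTriple k A' B') where
  P : Type (max v v')
  Q : Type (max v v')
  [addP : AddCommGroup P]
  [leftP : Module A P]
  [rightP : Module A'ᵐᵒᵖ P]
  [commP : SMulCommClass A A'ᵐᵒᵖ P]
  [addQ : AddCommGroup Q]
  [leftQ : Module A' Q]
  [rightQ : Module Aᵐᵒᵖ Q]
  [commQ : SMulCommClass A' Aᵐᵒᵖ Q]
  f : BalancedTensor A' P Q ≃+ A
  f_left : ∀ (a : A) z, f (BalancedTensor.leftAct a z) = a * f z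
  f_right : ∀ (a : A) z, f (BalancedTensor.rightAct a z) = f z * a
  g : BalancedTensor A Q P ≃+ A'
  g_left : ∀ (a : A') z, g (BalancedTensor.leftAct a z) = a * g z
  g_right : ∀ (a : A') z, g (BalancedTensor.rightAct a z) = g z * a
  η : B ≃ₐ[k] B'
  symm_P : ∀ (α : B) (p : P), T.ε α • p = op (T'.ε (η α)) • p
  symm_Q : ∀ (α : B) (q : Q), op (T.ε α) • q = T'.ε (η α) • q

namespace AlgTriple

section Morita

variable {k A B A' B' : Type*} [CommRing k] [Ring A] [CommRing B] [Algebra k A] [Algebra k B]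
    [Ring A'] [CommRing B'] [Algebra k A'] [Algebra k B']

/-- Morita equivalence of triples. -/
def MoritaEquivalent (T : AlgTriple k A B) (T' : AlgTriple k A' B') : Prop :=
  Nonempty (MoritaContext T T')

end Morita

section Matrices

variable (k : Type*) {A B : Type*} [CommRing k] [Ring A] [CommRing B] [Algebra k A] [Algebra k B]

variable (B) in
/-- The `k`-algebra `Iₙ(B)` of scalar matrices `diag(α, …, α)` with `α` in `B`. -/
def ScalarMatrices (n : ℕ) : Subalgebra k (Matrix (Fin n) (Fin n) B) :=
  (Matrix.scalarAlgHom (Fin n) k : B →ₐ[k] Matrix (Fin n) (Fin n) B).range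

instance (n : ℕ) : CommRing (ScalarMatrices k B n) where
  mul_comm := by
    rintro ⟨_, b, rfl⟩ ⟨_, c, rfl⟩
    exact Subtype.ext (((Matrix.scalarAlgHom (Fin n) k).map_mul b c).symm.trans
      ((congrArg _ (mul_comm b c)).trans ((Matrix.scalarAlgHom (Fin n) k).map_mul c b)))

variable {k} (T : AlgTriple k A B)

theorem map_scalar (n : ℕ) (b : B) :
    T.ε.mapMatrix (Matrix.scalarAlgHom (Fin n) k b) = Matrix.diagonal fun _ => T.ε b := by
  rw [Matrix.scalarAlgHom_apply, Matrix.scalar_apply, AlgHom.mapMatrix_apply,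
    Matrix.diagonal_map (map_zero _)]

/-- The triple `(Mₙ(A), Iₙ(B), ε_*)`, where `ε_*` applies `ε` entrywise, so that
`diag(α, …, α)` goes to `diag(ε(α), …, ε(α))`. -/
def matrix (n : ℕ) : AlgTriple k (Matrix (Fin n) (Fin n) A) (ScalarMatrices k B n) where
  ε := T.ε.mapMatrix.comp (ScalarMatrices k B n).val
  central := by
    rintro ⟨_, b, rfl⟩
    rw [Subalgebra.mem_center_iff]
    intro X
    change X * T.ε.mapMatrix (Matrix.scalarAlgHom (Fin n) k b) =
      T.ε.mapMatrix (Matrix.scalarAlgHom (Fin n) k b) * X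
    rw [T.map_scalar]
    ext i j
    rw [Matrix.mul_diagonal, Matrix.diagonal_mul, T.comm]

theorem ε_matrix (n : ℕ) (b : B) :
    (T.matrix n).ε ⟨Matrix.scalarAlgHom (Fin n) k b, b, rfl⟩ = Matrix.diagonal fun _ => T.ε b :=
  T.map_scalar n b

end Matrices

end AlgTriple

/-- The group `Mₙ(M)` of `n × n` matrices with entries in `M`; it is a bimodule over `Mₙ(A)` by
matrix multiplication when `M` is a bimodule over `A`. -/
def MatrixBimodule (n : ℕ) (M : Type*) : Type _ := Matrix (Fin n) (Fin n) M

namespace MatrixBimodule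

variable (n : ℕ) (k A M : Type*) [CommRing k] [Ring A] [Algebra k A] [AddCommGroup M] [Module k M] [Module A M] [Module Aᵐᵒᵖ M]

instance : AddCommGroup (MatrixBimodule n M) :=
  inferInstanceAs (AddCommGroup (Matrix (Fin n) (Fin n) M))

instance : Module k (MatrixBimodule n M) :=
  inferInstanceAs (Module k (Matrix (Fin n) (Fin n) M))

instance : Module (Matrix (Fin n) (Fin n) A) (MatrixBimodule n M) where
  smul X Y := fun i j => ∑ l, X i l • Y l j
  one_smul Y := by
    funext i j
    change ∑ l, (1 : Matrix (Fin n) (Fin n) A) i l • Y l j = Y i j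
    simp [Matrix.one_apply, ite_smul]
  mul_smul X X' Y := by
    funext i j
    change ∑ l, (X * X') i l • Y l j = ∑ l, X i l • ∑ l', X' l l' • Y l' j
    simp only [Matrix.mul_apply, Finset.sum_smul, Finset.smul_sum, mul_smul]
    exact Finset.sum_comm
  smul_zero X := by
    funext i j
    change ∑ l, X i l • (0 : M) = 0
    simp
  smul_add X Y Y' := by
    funext i j
    change ∑ l, X i l • (Y l j + Y' l j) = ∑ l, X i l • Y l j + ∑ l, X i l • Y' l j
    simp only [smul_add, Finset.sum_add_distrib]
  add_smul X X' Y := by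
    funext i j
    change ∑ l, (X i l + X' i l) • Y l j = ∑ l, X i l • Y l j + ∑ l, X' i l • Y l j
    simp only [add_smul, Finset.sum_add_distrib]
  zero_smul Y := by
    funext i j
    change ∑ l, (0 : A) • Y l j = 0
    simp

instance : Module (Matrix (Fin n) (Fin n) A)ᵐᵒᵖ (MatrixBimodule n M) where
  smul X Y := fun i j => ∑ l, op (X.unop l j) • Y i l
  one_smul Y := by
    funext i j
    change ∑ l, op ((1 : Matrix (Fin n) (Fin n) A) l j) • Y i l = Y i j
    simp [Matrix.one_apply, apply_ite op, ite_smul]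
  mul_smul X X' Y := by
    funext i j
    change ∑ l, op ((X'.unop * X.unop) l j) • Y i l =
      ∑ l, op (X.unop l j) • ∑ l', op (X'.unop l' l) • Y i l'
    simp only [Matrix.mul_apply, Finset.op_sum, Finset.sum_smul, Finset.smul_sum, op_mul, mul_smul]
    exact Finset.sum_comm
  smul_zero X := by
    funext i j
    change ∑ l, op (X.unop l j) • (0 : M) = 0
    simp
  smul_add X Y Y' := by
    funext i j
    change ∑ l, op (X.unop l j) • (Y i l + Y' i l) =
      ∑ l, op (X.unop l j) • Y i l + ∑ l, op (X.unop l j) • Y' i l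
    simp only [smul_add, Finset.sum_add_distrib]
  add_smul X X' Y := by
    funext i j
    change ∑ l, op (X.unop l j + X'.unop l j) • Y i l =
      ∑ l, op (X.unop l j) • Y i l + ∑ l, op (X'.unop l j) • Y i l
    simp only [op_add, add_smul, Finset.sum_add_distrib]
  zero_smul Y := by
    funext i j
    change ∑ l, op (0 : A) • Y i l = 0
    simp

variable {n A M}

theorem smul_apply (X : Matrix (Fin n) (Fin n) A) (Y : MatrixBimodule n M) (i j : Fin n) :
    (X • Y) i j = ∑ l, X i l • Y l j := rfl

theorem op_smul_apply (X : Matrix (Fin n) (Fin n) A) (Y : MatrixBimodule n M) (i j : Fin n) :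
    (op X • Y) i j = ∑ l, op (X l j) • Y i l := rfl

instance [SMulCommClass A Aᵐᵒᵖ M] : SMulCommClass (Matrix (Fin n) (Fin n) A)
    (Matrix (Fin n) (Fin n) A)ᵐᵒᵖ (MatrixBimodule n M) where
  smul_comm X X' Y := by
    funext i j
    change ∑ l, X i l • ∑ l', op (X'.unop l' j) • Y l l' =
      ∑ l', op (X'.unop l' j) • ∑ l, X i l • Y l l'
    simp only [Finset.smul_sum]
    rw [Finset.sum_comm]
    exact Finset.sum_congr rfl fun _ _ => Finset.sum_congr rfl fun _ _ => smul_comm _ _ _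

instance [IsScalarTower k A M] :
    IsScalarTower k (Matrix (Fin n) (Fin n) A) (MatrixBimodule n M) where
  smul_assoc c X Y := by
    funext i j
    change ∑ l, (c • X i l) • Y l j = c • ∑ l, X i l • Y l j
    simp only [Finset.smul_sum, smul_assoc]

instance [IsScalarTower k Aᵐᵒᵖ M] :
    IsScalarTower k (Matrix (Fin n) (Fin n) A)ᵐᵒᵖ (MatrixBimodule n M) where
  smul_assoc c X Y := by
    funext i j
    change ∑ l, op (c • X.unop l j) • Y i l = c • ∑ l, op (X.unop l j) • Y i l
    simp only [Finset.smul_sum, op_smul, smul_assoc]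

end MatrixBimodule

theorem AlgTriple.isSymmetric_matrix {k A B M : Type*} [CommRing k] [Ring A] [CommRing B]
    [Algebra k A] [Algebra k B] [AddCommGroup M] [Module A M] [Module Aᵐᵒᵖ M]
    (T : AlgTriple k A B) (hM : T.IsSymmetric M) (n : ℕ) :
    (T.matrix n).IsSymmetric (MatrixBimodule n M) := by
  rintro ⟨_, b, rfl⟩ Y
  have h : (T.matrix n).ε ⟨_, b, rfl⟩ = Matrix.diagonal fun _ => T.ε b := T.ε_matrix n b
  rw [h]
  funext i j
  rw [MatrixBimodule.op_smul_apply, MatrixBimodule.smul_apply]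
  rw [Finset.sum_eq_single j (fun l _ hl => by rw [Matrix.diagonal_apply_ne _ hl]; simp) (by simp),
    Finset.sum_eq_single i (fun l _ hl => by rw [Matrix.diagonal_apply_ne' _ hl]; simp) (by simp),
    Matrix.diagonal_apply_eq, Matrix.diagonal_apply_eq, hM]

end

/-! Morita equivalence. Rows `P = Aⁿ` and columns `Q = Aⁿ` are bimodules over `A` and `Mₙ(A)`. The
dot product identifies `P ⊗ Q` over `Mₙ(A)` with `A`, the product column times row identifies `Q ⊗_A
P` with `Mₙ(A)`, and `η` sends `α` to the scalar matrix `α I`. The compatibility of `η` with `P` and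
`Q` is the centrality of `ε(B)`. An index `o` of a row is fixed throughout; its existence is the
hypothesis `n ≥ 1`.

Homology. Since the algebra of scalar matrices is a copy of `B` and its image under `ε_*` consists
of constant diagonal matrices, the `B`-array takes no part in the matrix indices. The classical
argument for Hochschild homology therefore carries over. Chains over matrices are spanned by tensors
of matrix units `E_{x₀y₀}(m) ⊗ E_{x₁y₁}(a₀) ⊗ ⋯ ⊗ E_{xₙyₙ}(aₙ₋₁)`, together with an array over `B`.
The inclusion puts `E_{oo}` everywhere. The generalized trace keeps such a tensor when its indices
close up to a cycle, `y_t = x_{t+1}` and `yₙ = x₀`, and kills it otherwise. Both are chain maps, and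
trace after inclusion is the identity.

The other composite is homotopic to the identity by the presimplicial homotopy `h_j`, which requires
`y_t = x_{t+1}` for `t < j` and produces `E_{x₀o}(m) ⊗ E_{oo}(a₀) ⊗ ⋯ ⊗ E_{oo}(a_{j-1}) ⊗ E_{o
y_j}(1) ⊗ E_{x_{j+1}y_{j+1}}(a_j) ⊗ ⋯`, with a new row and column of ones in the array over `B`. The
first face of `h₀` is the identity, the last face of `hₙ` is inclusion after trace, and the
remaining terms cancel (`presimplicial_homotopy_sum`). The relations between `h_j` and the faces
come from the simplicial identities between faces and degeneracies (`natFace_natDegen_self` and the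
lemmas after it) and from the effect of faces on matrix units (`natFace_incl`, `natFace_last_incl`).
-/

noncomputable section

/-! ### Homological algebra: homotopy equivalences and presimplicial homotopies. -/

open CategoryTheory in
/-- A chain map with a one-sided inverse and a homotopy on the other side induces isomorphisms in
homology. -/
def ChainComplex.homologyIsoOfHomotopy {V : Type*} [Category V] [Preadditive V]
    [CategoryWithHomology V] {C D : ChainComplex V ℕ} (f : C ⟶ D) (g : D ⟶ C) (hfg : f ≫ g = 𝟙 C)
    (h : ∀ q, D.X q ⟶ D.X (q + 1)) (h0 : h 0 ≫ D.d 1 0 = 𝟙 _ - g.f 0 ≫ f.f 0)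
    (hs : ∀ q, D.d (q + 1) q ≫ h q + h (q + 1) ≫ D.d (q + 2) (q + 1) =
      𝟙 _ - g.f (q + 1) ≫ f.f (q + 1)) (i : ℕ) : C.homology i ≅ D.homology i :=
  HomotopyEquiv.toHomologyIso
    { hom := f
      inv := g
      homotopyHomInvId := Homotopy.ofEq hfg
      -- The maps `h` give a homotopy from the identity to `g ≫ f`, the reverse of the direction
      -- required here.
      homotopyInvHomId := Homotopy.symm
        { hom := fun i j => if e : i + 1 = j then h i ≫ eqToHom (by rw [e]) else 0
          zero := fun i j hij => dif_neg hij
          comm := fun i => by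
            rw [Homotopy.prevD_chainComplex]
            cases i with
            | zero =>
              -- No differential leaves degree `0`, so only one of the two terms of the homotopy
              -- relation is present; hence the separate hypothesis `h0`.
              rw [Homotopy.dNext_zero_chainComplex]
              simp [h0]
            | succ q =>
              rw [Homotopy.dNext_succ_chainComplex]
              simp [hs] } } i

open CategoryTheory in
/-- Isomorphisms in homology for complexes of modules given by sequences of linear maps. -/
def ModuleCat.homologyIsoOfHomotopy {k : Type u} [Ring k] {X Y : ℕ → Type v}
    [∀ n, AddCommGroup (X n)] [∀ n, Module k (X n)] [∀ n, AddCommGroup (Y n)] [∀ n, Module k (Y n)]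
    (dX : ∀ n, X (n + 1) →ₗ[k] X n) (dY : ∀ n, Y (n + 1) →ₗ[k] Y n)
    (hX : ∀ n, dX n ∘ₗ dX (n + 1) = 0) (hY : ∀ n, dY n ∘ₗ dY (n + 1) = 0)
    (f : ∀ n, X n →ₗ[k] Y n) (g : ∀ n, Y n →ₗ[k] X n) (h : ∀ n, Y n →ₗ[k] Y (n + 1))
    (hf : ∀ n, f n ∘ₗ dX n = dY n ∘ₗ f (n + 1)) (hg : ∀ n, g n ∘ₗ dY n = dX n ∘ₗ g (n + 1))
    (hfg : ∀ n x, g n (f n x) = x) (h0 : ∀ y, dY 0 (h 0 y) = y - f 0 (g 0 y))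
    (hs : ∀ n y, h n (dY n y) + dY (n + 1) (h (n + 1) y) = y - f (n + 1) (g (n + 1) y)) (i : ℕ) :
    (ChainComplex.of (fun n => ModuleCat.of k (X n)) (fun n => ModuleCat.ofHom (dX n))
        (fun n => by rw [← ModuleCat.ofHom_comp, hX n]; rfl)).homology i ≅
      (ChainComplex.of (fun n => ModuleCat.of k (Y n)) (fun n => ModuleCat.ofHom (dY n))
        (fun n => by rw [← ModuleCat.ofHom_comp, hY n]; rfl)).homology i :=
  ChainComplex.homologyIsoOfHomotopy
    (ChainComplex.ofHom (fun n => ModuleCat.ofHom (f n)) fun n => by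
      simp only [ChainComplex.of_d]
      rw [← ModuleCat.ofHom_comp, ← ModuleCat.ofHom_comp, hf])
    (ChainComplex.ofHom (fun n => ModuleCat.ofHom (g n)) fun n => by
      simp only [ChainComplex.of_d]
      rw [← ModuleCat.ofHom_comp, ← ModuleCat.ofHom_comp, hg])
    (by ext n x; exact hfg n x)
    (fun n => ModuleCat.ofHom (h n))
    (by
      simp only [ChainComplex.of_d]
      ext y; exact h0 y)
    (fun n => by
      have e : ChainComplex.of.d (fun n => ModuleCat.of k (Y n)) (fun n => ModuleCat.ofHom (dY n))
        (n + 2) (n + 1) = ModuleCat.ofHom (dY (n + 1)) := ChainComplex.of_d _ _ _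
      simp only [ChainComplex.of_d, e]
      ext y; exact hs n y) i

theorem LinearMap.sum_zsmul_apply {k X Y ι : Type*} [CommRing k] [AddCommGroup X] [AddCommGroup Y]
    [Module k X] [Module k Y] (s : Finset ι) (e : ι → ℤ) (f : ι → X →ₗ[k] Y) (x : X) :
    (∑ i ∈ s, e i • f i) x = ∑ i ∈ s, e i • f i x := by
  simp only [LinearMap.sum_apply, LinearMap.smul_apply]

theorem sum_zsmul_sum {X : Type*} [AddCommGroup X] (s t : Finset ℕ) (u : ℕ → ℕ → X) :
    ∑ i ∈ s, (-1 : ℤ) ^ i • ∑ j ∈ t, (-1 : ℤ) ^ j • u i j =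
      ∑ i ∈ s, ∑ j ∈ t, (-1 : ℤ) ^ (i + j) • u i j := by
  simp only [Finset.smul_sum, pow_add, mul_smul]

/-- The cancellation behind the fact that a presimplicial homotopy induces a chain homotopy. Think
of `G i j` as `d i ∘ h j` and of `K i j` as `h j ∘ d i`. -/
theorem presimplicial_homotopy_sum {X : Type*} [AddCommGroup X] (G K : ℕ → ℕ → X) (q : ℕ)
    (hlt : ∀ i j, i ≤ j → j < q → G i (j + 1) = K i j)
    (hdiag : ∀ j, j < q → G (j + 1) (j + 1) = G (j + 1) j)
    (hgt : ∀ i j, j < i → i ≤ q → G (i + 1) j = K i j) :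
    ∑ i ∈ Finset.range (q + 2), ∑ j ∈ Finset.range (q + 1), (-1 : ℤ) ^ (i + j) • G i j +
      ∑ i ∈ Finset.range (q + 1), ∑ j ∈ Finset.range q, (-1 : ℤ) ^ (i + j) • K i j =
    G 0 0 - G (q + 1) q := by
  -- The grid is cut into the regions `i < j`, `i = j`, `i = j + 1` and `i > j + 1`. On the two
  -- middle diagonals the exponent is `2j` and `2j + 1`, so the signs there are constant.
  have hsplit : ∀ i j, (-1 : ℤ) ^ (i + j) • G i j =
      (if i < j then (-1 : ℤ) ^ (i + j) • G i j else 0) + (if i = j then G j j else 0) +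
      (if i = j + 1 then - G (j + 1) j else 0) +
      (if j + 1 < i then (-1 : ℤ) ^ (i + j) • G i j else 0) := by
    intro i j
    rcases lt_trichotomy i j with h | h | h
    · simp [h, h.ne, (show ¬ i = j + 1 by omega), (show ¬ j + 1 < i by omega)]
    · subst h; simp [← two_mul]
    · rcases (show i = j + 1 ∨ j + 1 < i by omega) with rfl | h'
      · simp [show j + 1 + j = 2 * j + 1 by ring, pow_succ]
      · simp [h', h'.ne', (show ¬ i < j by omega), (show ¬ i = j by omega)]
  -- The upper region is reindexed by `j ↦ j + 1`. The shift reverses the sign, so that it cancels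
  -- the half `i ≤ j` of the `K`-terms.
  have h1 : ∑ i ∈ Finset.range (q + 2), ∑ j ∈ Finset.range (q + 1),
      (if i < j then (-1 : ℤ) ^ (i + j) • G i j else 0) =
      ∑ i ∈ Finset.range (q + 1), ∑ j ∈ Finset.range q,
        (if i ≤ j then - ((-1 : ℤ) ^ (i + j) • K i j) else 0) := by
    rw [Finset.sum_range_succ, Finset.sum_eq_zero (f := fun j => if q + 1 < j then _ else _),
      add_zero]
    · refine Finset.sum_congr rfl fun i _ => ?_
      rw [Finset.sum_range_succ', if_neg (by omega), add_zero]
      refine Finset.sum_congr rfl fun j hj => ?_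
      by_cases h : i ≤ j
      · rw [if_pos (by omega), if_pos h, hlt i j h (Finset.mem_range.mp hj), ← add_assoc, pow_succ]
        simp
      · rw [if_neg (by omega), if_neg h]
    · intro j hj
      rw [Finset.mem_range] at hj
      exact if_neg (by omega)
  -- The lower region is reindexed by `i ↦ i + 1` and cancels the half `j < i` of the `K`-terms.
  have h2 : ∑ i ∈ Finset.range (q + 2), ∑ j ∈ Finset.range (q + 1),
      (if j + 1 < i then (-1 : ℤ) ^ (i + j) • G i j else 0) =
      ∑ i ∈ Finset.range (q + 1), ∑ j ∈ Finset.range q,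
        (if j < i then - ((-1 : ℤ) ^ (i + j) • K i j) else 0) := by
    rw [Finset.sum_range_succ', Finset.sum_eq_zero (f := fun j => if j + 1 < 0 then _ else _),
      add_zero]
    · refine Finset.sum_congr rfl fun i hi => ?_
      rw [Finset.mem_range] at hi
      rw [Finset.sum_range_succ, if_neg (by omega), add_zero]
      refine Finset.sum_congr rfl fun j hj => ?_
      by_cases h : j < i
      · rw [if_pos (by omega), if_pos h, hgt i j h (by omega),
          show i + 1 + j = i + j + 1 by ring, pow_succ]
        simp
      · rw [if_neg (by omega), if_neg h]
    · intro j _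
      exact if_neg (by omega)
  have h3 : ∑ i ∈ Finset.range (q + 2), ∑ j ∈ Finset.range (q + 1), (if i = j then G j j else 0) =
      ∑ j ∈ Finset.range (q + 1), G j j := by
    rw [Finset.sum_comm]
    refine Finset.sum_congr rfl fun j hj => ?_
    rw [Finset.mem_range] at hj
    rw [Finset.sum_ite_eq' , if_pos (Finset.mem_range.mpr (by omega))]
  have h4 : ∑ i ∈ Finset.range (q + 2), ∑ j ∈ Finset.range (q + 1),
      (if i = j + 1 then - G (j + 1) j else 0) = - ∑ j ∈ Finset.range (q + 1), G (j + 1) j := by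
    rw [Finset.sum_comm, ← Finset.sum_neg_distrib]
    refine Finset.sum_congr rfl fun j hj => ?_
    rw [Finset.mem_range] at hj
    rw [Finset.sum_ite_eq' , if_pos (Finset.mem_range.mpr (by omega))]
  -- By `hdiag` the two diagonals telescope, leaving only the two extreme terms.
  have h5 : ∑ j ∈ Finset.range (q + 1), G j j - ∑ j ∈ Finset.range (q + 1), G (j + 1) j =
      G 0 0 - G (q + 1) q := by
    rw [Finset.sum_range_succ', Finset.sum_range_succ (fun j => G (j + 1) j),
      Finset.sum_congr rfl fun j hj => hdiag j (Finset.mem_range.mp hj)]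
    abel
  have h6 : ∑ i ∈ Finset.range (q + 1), ∑ j ∈ Finset.range q, (-1 : ℤ) ^ (i + j) • K i j =
      - (∑ i ∈ Finset.range (q + 1), ∑ j ∈ Finset.range q,
        (if i ≤ j then - ((-1 : ℤ) ^ (i + j) • K i j) else 0)) -
      ∑ i ∈ Finset.range (q + 1), ∑ j ∈ Finset.range q,
        (if j < i then - ((-1 : ℤ) ^ (i + j) • K i j) else 0) := by
    simp only [← Finset.sum_neg_distrib, ← Finset.sum_sub_distrib]
    refine Finset.sum_congr rfl fun i _ => Finset.sum_congr rfl fun j _ => ?_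
    by_cases h : i ≤ j
    · simp [h, not_lt.mpr h]
    · simp [h, not_le.mp h]
  rw [Finset.sum_congr rfl fun i _ => Finset.sum_congr rfl fun j _ => hsplit i j]
  simp only [Finset.sum_add_distrib, h1, h2, h3, h4]
  rw [h6, ← h5]
  abel

/-! ### Degeneracies of the secondary Hochschild complex. -/

namespace AlgTriple

section Degeneracies

variable {k A B : Type*} [CommRing k] [Ring A] [CommRing B] [Algebra k A] [Algebra k B]

variable (k) in
/-- The linear map `⨂_ι B → ⨂_κ B` multiplying the factors along the fibers of `σ`. -/
def pushB {ι κ : Type*} [Fintype ι] [DecidableEq ι] [DecidableEq κ] (σ : ι → κ) :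
    (⨂[k] _ : ι, B) →ₗ[k] (⨂[k] _ : κ, B) :=
  PiTensorProduct.lift <| MultilinearMap.mk'
    (fun b => PiTensorProduct.tprod k (fiberProd σ b))
    (fun b i x y => by simp [fiberProd_update, add_mul])
    (fun b i c x => by simp [fiberProd_update])

@[simp] theorem pushB_tprod {ι κ : Type*} [Fintype ι] [DecidableEq ι] [DecidableEq κ] (σ : ι → κ)
    (b : ι → B) : pushB k σ (PiTensorProduct.tprod k b) =
      PiTensorProduct.tprod k (fiberProd σ b) := by
  simp [pushB]

theorem fiberProd_fiberProd {ι κ μ : Type*} [Fintype ι] [DecidableEq ι] [Fintype κ] [DecidableEq κ]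
    [DecidableEq μ] (σ : ι → κ) (τ : κ → μ) (b : ι → B) (t : μ) :
    fiberProd τ (fiberProd σ b) t = fiberProd (fun q => τ (σ q)) b t := by
  simp only [fiberProd]
  rw [← Finset.prod_biUnion]
  · refine Finset.prod_congr ?_ fun _ _ => rfl
    ext q
    simp
  · intro x _ y _ hxy
    rw [Function.onFun, Finset.disjoint_left]
    intro q hq hq'
    simp only [Finset.mem_filter, Finset.mem_univ, true_and] at hq hq'
    exact hxy (hq.symm.trans hq')

/-- This and `fiberProd_map_none` describe a face followed by a degeneracy on the array over `B`. A
degeneracy relabels the surviving entries, while the factor collected by the face at `none` stays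
the same. -/
theorem fiberProd_map {ι κ μ : Type*} [Fintype ι] [DecidableEq ι] [Fintype κ] [DecidableEq κ]
    [DecidableEq μ] (σ : ι → Option κ) (τ : κ → μ) (b : ι → B) (t : μ) :
    fiberProd τ (fun r => fiberProd σ b (some r)) t =
      fiberProd (fun q => (σ q).map τ) b (some t) := by
  have := fiberProd_comp σ (fun r => some (τ r)) b (some t)
  simp only [fiberProd, Option.some.injEq, Option.map_eq_some_iff] at this ⊢
  exact this

theorem fiberProd_map_none {ι κ μ : Type*} [Fintype ι] [DecidableEq κ]
    [DecidableEq μ] (σ : ι → Option κ) (τ : κ → μ) (b : ι → B) :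
    fiberProd (fun q => (σ q).map τ) b none = fiberProd σ b none := by
  simp only [fiberProd, Option.map_eq_none_iff]

/-- The labelling `some` arises when a face undoes a degeneracy: every fiber is a single entry and
the collected factor is an empty product. -/
theorem fiberProd_some {ι : Type*} [Fintype ι] [DecidableEq ι] (b : ι → B) (i : ι) :
    fiberProd some b (some i) = b i := by
  simp [fiberProd, Finset.filter_eq']

theorem fiberProd_some_none {ι : Type*} [Fintype ι] [DecidableEq ι] (b : ι → B) :
    fiberProd some b none = 1 := by
  simp [fiberProd]

/-- The positions of the `(n + 1) × (n + 1)` array avoiding row and column `j`. -/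
def skip {n : ℕ} (j : Fin (n + 1)) (r : Pairs n) : Pairs (n + 1) :=
  ⟨(j.succAbove r.1.1, j.succAbove r.1.2), Fin.succAbove_lt_succAbove_iff.mpr r.2⟩

/-- Explicit values turn the identities between maps of positions into linear arithmetic. -/
theorem val_succAbove {n : ℕ} (j : Fin (n + 1)) (i : Fin n) :
    (j.succAbove i).val = if i.val < j.val then i.val else i.val + 1 := by
  simp only [Fin.succAbove, Fin.lt_def, Fin.val_castSucc]
  split_ifs <;> simp

theorem val_skip_fst {n : ℕ} (j : Fin (n + 1)) (r : Pairs n) : (skip j r).1.1.val =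
    if r.1.1.val < j.val then r.1.1.val else r.1.1.val + 1 := val_succAbove j _

theorem val_skip_snd {n : ℕ} (j : Fin (n + 1)) (r : Pairs n) : (skip j r).1.2.val =
    if r.1.2.val < j.val then r.1.2.val else r.1.2.val + 1 := val_succAbove j _

/-- Here and in the next three lemmas, a face removes the row and column just inserted: the shadow
on positions of `d_j s_j = d_{j+1} s_j = 1`. -/
theorem dropFirst_skip_zero {n : ℕ} (r : Pairs n) : dropFirst (skip 0 r) = some r := by
  rw [dropFirst_eq_some, val_skip_fst, val_skip_snd]
  simp

theorem dropLast_skip_last {n : ℕ} (r : Pairs n) : dropLast (skip (Fin.last n) r) = some r := by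
  rw [dropLast_eq_some, val_skip_fst, val_skip_snd]
  simp

theorem merge_skip_castSucc {n : ℕ} (p : Fin n) (r : Pairs n) :
    merge p (skip p.castSucc r) = some r := by
  rw [merge_eq_some, val_skip_fst, val_skip_snd, Fin.val_castSucc]
  split_ifs <;> omega

theorem merge_skip_succ {n : ℕ} (p : Fin n) (r : Pairs n) :
    merge p (skip p.succ r) = some r := by
  rw [merge_eq_some, val_skip_fst, val_skip_snd, Fin.val_succ]
  split_ifs <;> omega

/-- Here and in the next three lemmas, the inserted row and column lie away from those affected by
the face, so the two operations commute up to a shift of index. -/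
theorem dropFirst_skip_succ {n : ℕ} (j : Fin (n + 1)) (r : Pairs (n + 1)) :
    dropFirst (skip j.succ r) = (dropFirst r).map (skip j) := by
  have hr := r.2
  rw [Fin.lt_def] at hr
  rcases h : dropFirst r with _ | t
  · rw [dropFirst_eq_none] at h
    simp only [Option.map_none, dropFirst_eq_none, val_skip_fst, Fin.val_succ]
    split_ifs <;> omega
  · rw [dropFirst_eq_some] at h
    simp only [Option.map_some, dropFirst_eq_some, val_skip_fst, val_skip_snd, Fin.val_succ]
    split_ifs <;> omega

theorem dropLast_skip_castSucc {n : ℕ} (j : Fin (n + 1)) (r : Pairs (n + 1)) :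
    dropLast (skip j.castSucc r) = (dropLast r).map (skip j) := by
  have hr := r.2
  have hj := j.isLt
  rw [Fin.lt_def] at hr
  rcases h : dropLast r with _ | t
  · rw [dropLast_eq_none] at h
    simp only [Option.map_none, dropLast_eq_none, val_skip_snd, Fin.val_castSucc]
    split_ifs <;> omega
  · rw [dropLast_eq_some] at h
    simp only [Option.map_some, dropLast_eq_some, val_skip_fst, val_skip_snd, Fin.val_castSucc]
    split_ifs <;> omega

theorem merge_skip_of_lt {n : ℕ} {p : Fin n} {j : Fin (n + 1)} (hp : p.val < j.val)
    (r : Pairs (n + 1)) :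
    merge p.castSucc (skip j.succ r) = (merge p r).map (skip j) := by
  have hr := r.2
  rw [Fin.lt_def] at hr
  rcases h : merge p r with _ | t
  · rw [merge_eq_none] at h
    simp only [Option.map_none, merge_eq_none, val_skip_fst, val_skip_snd, Fin.val_succ,
      Fin.val_castSucc]
    split_ifs <;> omega
  · rw [merge_eq_some] at h
    simp only [Option.map_some, merge_eq_some, val_skip_fst, val_skip_snd, Fin.val_succ,
      Fin.val_castSucc]
    split_ifs <;> omega

theorem merge_skip_of_le {n : ℕ} {p : Fin n} {j : Fin (n + 1)} (hp : j.val ≤ p.val)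
    (r : Pairs (n + 1)) :
    merge p.succ (skip j.castSucc r) = (merge p r).map (skip j) := by
  have hr := r.2
  rw [Fin.lt_def] at hr
  rcases h : merge p r with _ | t
  · rw [merge_eq_none] at h
    simp only [Option.map_none, merge_eq_none, val_skip_fst, val_skip_snd, Fin.val_succ,
      Fin.val_castSucc]
    split_ifs <;> omega
  · rw [merge_eq_some] at h
    simp only [Option.map_some, merge_eq_some, val_skip_fst, val_skip_snd, Fin.val_succ,
      Fin.val_castSucc]
    split_ifs <;> omega

/-- The diagonal obtained by inserting `1` at position `j`. -/
def insertOne {n : ℕ} (j : Fin (n + 1)) (a : Fin n → A) : Fin (n + 1) → A :=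
  j.insertNth (1 : A) a

theorem insertOne_self {n : ℕ} {j i : Fin (n + 1)} (a : Fin n → A) (h : i.val = j.val) :
    insertOne j a i = 1 := by
  obtain rfl := Fin.ext h
  simp [insertOne]

theorem insertOne_of_lt {n : ℕ} {j i : Fin (n + 1)} (a : Fin n → A) (h : i.val < j.val) :
    insertOne j a i = a ⟨i.val, by omega⟩ := by
  obtain ⟨i', rfl⟩ : ∃ i', i = j.succAbove i' :=
    ⟨⟨i.val, by omega⟩, Fin.ext (by rw [val_succAbove, if_pos h])⟩
  rw [insertOne, Fin.insertNth_apply_succAbove]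
  congr 1
  refine Fin.ext ?_
  rw [val_succAbove] at h ⊢
  split_ifs at * <;> simp; omega

theorem insertOne_of_gt {n : ℕ} {j i : Fin (n + 1)} (a : Fin n → A) (h : j.val < i.val) :
    insertOne j a i = a ⟨i.val - 1, by omega⟩ := by
  obtain ⟨i', rfl⟩ : ∃ i', i = j.succAbove i' :=
    ⟨⟨i.val - 1, by omega⟩, Fin.ext (by rw [val_succAbove, if_neg (by simp; omega)]; simp; omega)⟩
  rw [insertOne, Fin.insertNth_apply_succAbove]
  congr 1
  refine Fin.ext (?_ : i'.val = (j.succAbove i').val - 1)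
  rw [val_succAbove] at h ⊢
  split_ifs at * <;> omega

variable (A B) in
/-- The degeneracy inserting a row and a column with all entries equal to `1`. -/
def degen (M : Type*) [AddCommGroup M] [Module k M] {n : ℕ} (j : Fin (n + 1)) :
    Chain k A B M n →ₗ[k] Chain k A B M (n + 1) :=
  TensorProduct.map ((PiTensorProduct.lift (s := fun _ : Fin n => A) (MultilinearMap.curryMid
    (M := fun _ : Fin (n + 1) => A) j (PiTensorProduct.tprod k) 1)).lTensor M)
    (pushB k (skip j))

theorem degen_pure {M : Type*} [AddCommGroup M] [Module k M] {n : ℕ} (j : Fin (n + 1)) (m : M)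
    (a : Fin n → A) (b : Pairs n → B) : degen A B M j (pureChain k m a b) =
      pureChain k m (insertOne j a) (fiberProd (skip j) b) := by
  simp [degen, pureChain, insertOne]

variable (T : AlgTriple k A B)

variable (M : Type*) [AddCommGroup M] [Module k M] [Module A M] [Module Aᵐᵒᵖ M]
  [IsScalarTower k A M] [IsScalarTower k Aᵐᵒᵖ M]

/-- The coefficient is multiplied by the inserted diagonal entry and by the image of the inserted
row, both equal to `1`. -/
theorem faceFirst_degen_zero {n : ℕ} (c : Chain k A B M n) :
    T.faceFirst M n (degen A B M 0 c) = c := by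
  refine LinearMap.congr_fun (f := T.faceFirst M n ∘ₗ degen A B M 0) (g := LinearMap.id)
    (chain_ext fun m a b => ?_) c
  simp only [LinearMap.comp_apply, degen_pure, faceFirst_pure, fiberProd_fiberProd,
    dropFirst_skip_zero, fiberProd_some, fiberProd_some_none, LinearMap.id_apply]
  refine pure_congr ?_ ?_ rfl
  · rw [insertOne_self _ rfl]; simp
  · funext i
    rw [insertOne_of_gt _ (by simp)]; rfl

theorem faceLast_degen_last {n : ℕ} (c : Chain k A B M n) :
    T.faceLast M n (degen A B M (Fin.last n) c) = c := by
  refine LinearMap.congr_fun (f := T.faceLast M n ∘ₗ degen A B M _) (g := LinearMap.id)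
    (chain_ext fun m a b => ?_) c
  simp only [LinearMap.comp_apply, degen_pure, faceLast_pure, fiberProd_fiberProd,
    dropLast_skip_last, fiberProd_some, fiberProd_some_none, LinearMap.id_apply]
  refine pure_congr ?_ ?_ rfl
  · rw [insertOne_self _ rfl]; simp
  · funext i
    rw [insertOne_of_lt _ (by simp)]; rfl

theorem faceFirst_degen_succ {n : ℕ} (j : Fin (n + 1)) (c : Chain k A B M (n + 1)) :
    T.faceFirst M (n + 1) (degen A B M j.succ c) = degen A B M j (T.faceFirst M n c) := by
  refine LinearMap.congr_fun (f := T.faceFirst M (n + 1) ∘ₗ degen A B M j.succ)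
    (g := degen A B M j ∘ₗ T.faceFirst M n) (chain_ext fun m a b => ?_) c
  simp only [LinearMap.comp_apply, degen_pure, faceFirst_pure, fiberProd_fiberProd,
    dropFirst_skip_succ, fiberProd_map_none]
  refine pure_congr ?_ ?_ ?_
  · rw [insertOne_of_lt _ (by simp)]; rfl
  · funext i
    rcases lt_trichotomy i.val j.val with h | h | h
    · rw [insertOne_of_lt _ (by simpa using h), insertOne_of_lt _ h]; rfl
    · rw [insertOne_self _ (by simpa using h), insertOne_self _ h]
    · rw [insertOne_of_gt _ (by simpa using h), insertOne_of_gt _ h]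
      congr 1; refine Fin.ext ?_; simp; omega
  · funext r
    exact (fiberProd_map _ _ _ _).symm

theorem faceLast_degen_castSucc {n : ℕ} (j : Fin (n + 1)) (c : Chain k A B M (n + 1)) :
    T.faceLast M (n + 1) (degen A B M j.castSucc c) = degen A B M j (T.faceLast M n c) := by
  refine LinearMap.congr_fun (f := T.faceLast M (n + 1) ∘ₗ degen A B M j.castSucc)
    (g := degen A B M j ∘ₗ T.faceLast M n) (chain_ext fun m a b => ?_) c
  simp only [LinearMap.comp_apply, degen_pure, faceLast_pure, fiberProd_fiberProd,
    dropLast_skip_castSucc, fiberProd_map_none]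
  refine pure_congr ?_ ?_ ?_
  · rw [insertOne_of_gt _ (by have := j.isLt; simp; omega)]; rfl
  · funext i
    rcases lt_trichotomy i.val j.val with h | h | h
    · rw [insertOne_of_lt _ (by simpa using h), insertOne_of_lt _ h]; rfl
    · rw [insertOne_self _ (by simpa using h), insertOne_self _ h]
    · rw [insertOne_of_gt _ (by simpa using h), insertOne_of_gt _ h]; rfl
  · funext r
    exact (fiberProd_map _ _ _ _).symm

/-- The inserted `1` is the left one of the two merged diagonal entries, and the entry of `B`
between them is `1`. In `faceMid_degen_succ` it is the right one. -/
theorem faceMid_degen_castSucc {n : ℕ} (p : Fin n) (c : Chain k A B M n) :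
    T.faceMid M p (degen A B M p.castSucc c) = c := by
  refine LinearMap.congr_fun (f := T.faceMid M p ∘ₗ degen A B M _) (g := LinearMap.id)
    (chain_ext fun m a b => ?_) c
  simp only [LinearMap.comp_apply, degen_pure, faceMid_pure, fiberProd_fiberProd,
    merge_skip_castSucc, fiberProd_some, fiberProd_some_none, LinearMap.id_apply]
  refine pure_congr rfl ?_ rfl
  funext i
  rcases lt_trichotomy i.val p.val with h | h | h
  · rw [T.mergeA_of_lt _ _ h, insertOne_of_lt _ (by simpa using h)]; rfl
  · obtain rfl := Fin.ext h
    rw [T.mergeA_self, insertOne_self _ rfl, insertOne_of_gt _ (by simp)]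
    simp
  · rw [T.mergeA_of_gt _ _ h, insertOne_of_gt _ (by simp; omega)]; rfl

theorem faceMid_degen_succ {n : ℕ} (p : Fin n) (c : Chain k A B M n) :
    T.faceMid M p (degen A B M p.succ c) = c := by
  refine LinearMap.congr_fun (f := T.faceMid M p ∘ₗ degen A B M _) (g := LinearMap.id)
    (chain_ext fun m a b => ?_) c
  simp only [LinearMap.comp_apply, degen_pure, faceMid_pure, fiberProd_fiberProd,
    merge_skip_succ, fiberProd_some, fiberProd_some_none, LinearMap.id_apply]
  refine pure_congr rfl ?_ rfl
  funext i
  rcases lt_trichotomy i.val p.val with h | h | h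
  · rw [T.mergeA_of_lt _ _ h, insertOne_of_lt _ (by simp; omega)]; rfl
  · obtain rfl := Fin.ext h
    rw [T.mergeA_self, insertOne_self _ rfl, insertOne_of_lt _ (by simp)]
    simp
  · rw [T.mergeA_of_gt _ _ h, insertOne_of_gt _ (by simpa using h)]; rfl

/-- The unit sits at `j + 1 > p + 1`, to the right of the merged entries `p` and `p + 1`. -/
theorem faceMid_degen_of_lt {n : ℕ} {p : Fin n} {j : Fin (n + 1)} (hp : p.val < j.val)
    (c : Chain k A B M (n + 1)) :
    T.faceMid M p.castSucc (degen A B M j.succ c) = degen A B M j (T.faceMid M p c) := by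
  refine LinearMap.congr_fun (f := T.faceMid M p.castSucc ∘ₗ degen A B M j.succ)
    (g := degen A B M j ∘ₗ T.faceMid M p) (chain_ext fun m a b => ?_) c
  simp only [LinearMap.comp_apply, degen_pure, faceMid_pure, fiberProd_fiberProd,
    merge_skip_of_lt hp, fiberProd_map_none]
  refine pure_congr rfl ?_ ?_
  · generalize fiberProd (merge p) b none = z
    funext i
    rcases lt_trichotomy i.val p.val with h | h | h
    · rw [T.mergeA_of_lt _ _ (by simpa using h), insertOne_of_lt _ (by simp; omega),
        insertOne_of_lt _ (by omega), T.mergeA_of_lt _ _ (by simpa using h)]; rfl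
    · obtain rfl : i = p.castSucc := Fin.ext h
      rw [T.mergeA_self, insertOne_of_lt _ (by simp; omega), insertOne_of_lt _ (by simp; omega),
        insertOne_of_lt _ (by simpa using hp)]
      exact (T.mergeA_self p a z).symm
    · rw [T.mergeA_of_gt _ _ (by simpa using h)]
      rcases lt_trichotomy i.val j.val with h' | h' | h'
      · rw [insertOne_of_lt _ (by simpa using h'), insertOne_of_lt _ h', T.mergeA_of_gt _ _ h]; rfl
      · rw [insertOne_self _ (by simpa using h'), insertOne_self _ h']
      · rw [insertOne_of_gt _ (by simpa using h'), insertOne_of_gt _ h',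
          T.mergeA_of_gt _ _ (by simp; omega)]
        congr 1; refine Fin.ext ?_; simp; omega
  · funext r
    exact (fiberProd_map _ _ _ _).symm

/-- The unit sits at `j ≤ p`, to the left of the merged entries `p + 1` and `p + 2`. -/
theorem faceMid_degen_of_le {n : ℕ} {p : Fin n} {j : Fin (n + 1)} (hp : j.val ≤ p.val)
    (c : Chain k A B M (n + 1)) :
    T.faceMid M p.succ (degen A B M j.castSucc c) = degen A B M j (T.faceMid M p c) := by
  refine LinearMap.congr_fun (f := T.faceMid M p.succ ∘ₗ degen A B M j.castSucc)
    (g := degen A B M j ∘ₗ T.faceMid M p) (chain_ext fun m a b => ?_) c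
  simp only [LinearMap.comp_apply, degen_pure, faceMid_pure, fiberProd_fiberProd,
    merge_skip_of_le hp, fiberProd_map_none]
  refine pure_congr rfl ?_ ?_
  · generalize fiberProd (merge p) b none = z
    funext i
    rcases lt_trichotomy i.val (p.val + 1) with h | h | h
    · rw [T.mergeA_of_lt _ _ (by simpa using h)]
      rcases lt_trichotomy i.val j.val with h' | h' | h'
      · rw [insertOne_of_lt _ (by simpa using h'), insertOne_of_lt _ h',
          T.mergeA_of_lt _ _ (by simp; omega)]; rfl
      · rw [insertOne_self _ (by simpa using h'), insertOne_self _ h']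
      · rw [insertOne_of_gt _ (by simpa using h'), insertOne_of_gt _ h',
          T.mergeA_of_lt _ _ (by simp; omega)]; rfl
    · obtain rfl : i = p.succ := Fin.ext h
      rw [T.mergeA_self, insertOne_of_gt _ (by simp; omega), insertOne_of_gt _ (by simp; omega),
        insertOne_of_gt _ (by simp; omega)]
      exact (T.mergeA_self p a z).symm
    · rw [T.mergeA_of_gt _ _ (by simpa using h), insertOne_of_gt _ (by simp; omega),
        insertOne_of_gt _ (by omega), T.mergeA_of_gt _ _ (by simp; omega)]
      congr 1; refine Fin.ext ?_; simp; omega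
  · funext r
    exact (fiberProd_map _ _ _ _).symm

end Degeneracies

end AlgTriple

/-! ### Simplicial identities with faces and degeneracies indexed by natural numbers. -/

namespace AlgTriple

section NatFaces

variable {k A B : Type*} [CommRing k] [Ring A] [CommRing B] [Algebra k A] [Algebra k B]
variable (T : AlgTriple k A B)
variable (M : Type*) [AddCommGroup M] [Module k M] [Module A M] [Module Aᵐᵒᵖ M]
  [IsScalarTower k A M] [IsScalarTower k Aᵐᵒᵖ M]

/-- The face `dᵢ` indexed by a natural number, zero when `i` is out of range. -/
def natFace (n i : ℕ) : Chain k A B M (n + 1) →ₗ[k] Chain k A B M n :=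
  if h : i < n + 2 then T.face M n ⟨i, h⟩ else 0

variable (k A B) in
/-- The degeneracy `sⱼ` indexed by a natural number, zero when `j` is out of range. -/
def natDegen (n j : ℕ) : Chain k A B M n →ₗ[k] Chain k A B M (n + 1) :=
  if h : j < n + 1 then degen A B M ⟨j, h⟩ else 0

theorem natFace_zero (n : ℕ) : T.natFace M n 0 = T.faceFirst M n := by
  simp only [natFace, Nat.zero_lt_succ, dif_pos]
  exact T.face_zero M n

theorem natFace_last (n : ℕ) : T.natFace M n (n + 1) = T.faceLast M n := by
  simp only [natFace, Nat.lt_succ_self, dif_pos]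
  exact T.face_last M n

/-- The shift by one comes from counting the coefficient as place `0`: diagonal entry `p` is place
`p + 1`, and `d_i` contracts the places `i` and `i + 1`. -/
theorem natFace_mid {n p : ℕ} (h : p < n) : T.natFace M n (p + 1) = T.faceMid M ⟨p, h⟩ := by
  rw [natFace, dif_pos (by omega)]
  exact T.face_mid M ⟨p, h⟩

theorem natDegen_of_le {n j : ℕ} (h : j ≤ n) :
    natDegen k A B M n j = degen A B M ⟨j, Nat.lt_succ_of_le h⟩ :=
  dif_pos _

theorem boundary_eq_sum_natFace (n : ℕ) :
    T.boundary M n = ∑ i ∈ Finset.range (n + 2), (-1 : ℤ) ^ i • T.natFace M n i := by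
  rw [boundary_eq, Finset.sum_range]
  refine Finset.sum_congr rfl fun i _ => ?_
  rw [natFace, dif_pos i.isLt]

theorem boundary_apply (n : ℕ) (c : Chain k A B M (n + 1)) :
    T.boundary M n c = ∑ i ∈ Finset.range (n + 2), (-1 : ℤ) ^ i • T.natFace M n i c := by
  rw [boundary_eq_sum_natFace]
  exact LinearMap.sum_zsmul_apply _ _ _ c

/-- The homotopy needs only this identity and the next three, which relate faces to degeneracies;
relations among degeneracies play no role. -/
theorem natFace_natDegen_self {n j : ℕ} (h : j ≤ n) (c : Chain k A B M n) :
    T.natFace M n j (natDegen k A B M n j c) = c := by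
  rw [natDegen_of_le M h]
  rcases j with _ | p
  · rw [natFace_zero]
    exact T.faceFirst_degen_zero M c
  · rw [natFace_mid T M h]
    exact T.faceMid_degen_succ M ⟨p, h⟩ c

theorem natFace_succ_natDegen {n j : ℕ} (h : j ≤ n) (c : Chain k A B M n) :
    T.natFace M n (j + 1) (natDegen k A B M n j c) = c := by
  rw [natDegen_of_le M h]
  rcases h.lt_or_eq with h' | rfl
  · rw [natFace_mid T M h']
    exact T.faceMid_degen_castSucc M ⟨j, h'⟩ c
  · rw [natFace_last]
    exact T.faceLast_degen_last M c

theorem natFace_natDegen_of_le {n i j : ℕ} (h : i ≤ j) (hj : j ≤ n) (c : Chain k A B M (n + 1)) :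
    T.natFace M (n + 1) i (natDegen k A B M (n + 1) (j + 1) c) =
      natDegen k A B M n j (T.natFace M n i c) := by
  rw [natDegen_of_le M hj, natDegen_of_le M (Nat.succ_le_succ hj)]
  rcases i with _ | p
  · rw [natFace_zero, natFace_zero]
    exact T.faceFirst_degen_succ M ⟨j, Nat.lt_succ_of_le hj⟩ c
  · rw [natFace_mid T M (show p < n by omega), natFace_mid T M (show p < n + 1 by omega)]
    exact T.faceMid_degen_of_lt M (p := ⟨p, by omega⟩) (j := ⟨j, by omega⟩) h c

theorem natFace_natDegen_of_lt {n i j : ℕ} (h : j < i) (hi : i ≤ n + 1)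
    (c : Chain k A B M (n + 1)) :
    T.natFace M (n + 1) (i + 1) (natDegen k A B M (n + 1) j c) =
      natDegen k A B M n j (T.natFace M n i c) := by
  have hn : j ≤ n := by omega
  rw [natDegen_of_le M hn, natDegen_of_le M (Nat.le_succ_of_le hn)]
  rcases hi.lt_or_eq with h' | rfl
  · obtain ⟨p, rfl⟩ : ∃ p, i = p + 1 := ⟨i - 1, by omega⟩
    rw [natFace_mid T M (show p < n by omega),
      natFace_mid T M (show p + 1 < n + 1 by omega)]
    exact T.faceMid_degen_of_le M (p := ⟨p, by omega⟩) (j := ⟨j, by omega⟩)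
      (Nat.le_of_lt_succ h) c
  · rw [natFace_last, natFace_last]
    exact T.faceLast_degen_castSucc M ⟨j, h⟩ c

end NatFaces

/-! ### Decomposition of chains over matrices by matrix units. -/

section ElementaryMatrices

variable {k A B : Type*} [CommRing k] [Ring A] [CommRing B] [Algebra k A] [Algebra k B]
variable {M : Type*} [AddCommGroup M] [Module k M]
variable {N : ℕ}

variable (k B N) in
/-- The surjection from `B` to the algebra of scalar matrices. -/
def toScalar : B →ₐ[k] ScalarMatrices k B N :=
  (Matrix.scalarAlgHom (Fin N) k : B →ₐ[k] Matrix (Fin N) (Fin N) B).rangeRestrict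

variable (k B) in
/-- The diagonal entry of a scalar matrix. -/
def ofScalar (o : Fin N) : ScalarMatrices k B N →ₗ[k] B :=
  Matrix.entryLinearMap k B o o ∘ₗ (ScalarMatrices k B N).val.toLinearMap

theorem ofScalar_toScalar (o : Fin N) (b : B) : ofScalar k B o (toScalar k B N b) = b := by
  change (Matrix.scalarAlgHom (Fin N) k b) o o = b
  simp

theorem toScalar_surjective : Function.Surjective (toScalar k B N) :=
  AlgHom.rangeRestrict_surjective _

variable (k M) in
/-- The matrix in `Mₙ(M)` with a single nonzero entry. -/
def singleM (r s : Fin N) : M →ₗ[k] MatrixBimodule N M :=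
  (Matrix.singleLinearMap k r s : M →ₗ[k] Matrix (Fin N) (Fin N) M)

variable (k M) in
/-- The entries of an element of `Mₙ(M)`. -/
def entryM (r s : Fin N) : MatrixBimodule N M →ₗ[k] M :=
  (Matrix.entryLinearMap k M r s : Matrix (Fin N) (Fin N) M →ₗ[k] M)

theorem singleM_apply (r s i j : Fin N) (m : M) :
    singleM k M r s m i j = if r = i ∧ s = j then m else 0 :=
  Matrix.single_apply (α := M) r s m i j

theorem entryM_singleM (r s i j : Fin N) (m : M) :
    entryM k M i j (singleM k M r s m) = if r = i ∧ s = j then m else 0 :=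
  singleM_apply (k := k) r s i j m

theorem sum_singleM (Y : MatrixBimodule N M) :
    Y = ∑ z : Fin N × Fin N, singleM k M z.1 z.2 (Y z.1 z.2) := by
  rw [Fintype.sum_prod_type]
  exact Matrix.matrix_eq_sum_single (α := M) Y

variable (k A B M) in
/-- The inclusion `m ⊗ (a, b) ↦ E_{x₀y₀}(m) ⊗ (E_{x₁y₁}(a₀), …; b)` of chains over `(A, B)` into
chains over matrices. -/
def incl (n : ℕ) (x y : ℕ → Fin N) : Chain k A B M n →ₗ[k]
    Chain k (Matrix (Fin N) (Fin N) A) (ScalarMatrices k B N) (MatrixBimodule N M) n :=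
  TensorProduct.map (TensorProduct.map (singleM k M (x 0) (y 0))
    (PiTensorProduct.map fun j : Fin n => Matrix.singleLinearMap k (x (j + 1)) (y (j + 1))))
    (PiTensorProduct.map fun _ => (toScalar k B N).toLinearMap)

variable (k A B M) in
/-- The projection taking the entries `x₀, y₀` of the coefficient and `xᵢ₊₁, yᵢ₊₁` of the `i`-th
diagonal entry. -/
def proj (o : Fin N) (n : ℕ) (x y : ℕ → Fin N) :
    Chain k (Matrix (Fin N) (Fin N) A) (ScalarMatrices k B N) (MatrixBimodule N M) n →ₗ[k]
      Chain k A B M n :=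
  TensorProduct.map (TensorProduct.map (entryM k M (x 0) (y 0))
    (PiTensorProduct.map fun j : Fin n => Matrix.entryLinearMap k A (x (j + 1)) (y (j + 1))))
    (PiTensorProduct.map fun _ => ofScalar k B o)

theorem incl_pure (n : ℕ) (x y : ℕ → Fin N) (m : M) (a : Fin n → A) (b : Pairs n → B) :
    incl k A B M n x y (pureChain k m a b) = pureChain k (singleM k M (x 0) (y 0) m)
      (fun j => Matrix.single (x (j + 1)) (y (j + 1)) (a j)) (fun r => toScalar k B N (b r)) := by
  simp [incl, pureChain, PiTensorProduct.map_tprod]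

/-- Index sequences are functions on all of `ℕ`, which avoids casts when a face or degeneracy
changes the degree; only the terms `0, …, n` count. -/
theorem incl_congr {n : ℕ} {x y x' y' : ℕ → Fin N} (hx : ∀ t ≤ n, x t = x' t)
    (hy : ∀ t ≤ n, y t = y' t) : incl k A B M n x y = incl k A B M n x' y' := by
  refine chain_ext fun m a b => ?_
  rw [incl_pure, incl_pure, hx 0 (Nat.zero_le _), hy 0 (Nat.zero_le _)]
  refine pure_congr rfl ?_ rfl
  funext j
  rw [hx _ j.isLt, hy _ j.isLt]

/-- Matrix entries are dual to matrix units, so a product of Kronecker deltas appears, one for each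
place. On the factors from `B`, `ofScalar` undoes `toScalar`. -/
theorem proj_incl (o : Fin N) (n : ℕ) (x y x' y' : ℕ → Fin N) (c : Chain k A B M n) :
    proj k A B M o n x y (incl k A B M n x' y' c) =
      if ∀ t ≤ n, x' t = x t ∧ y' t = y t then c else 0 := by
  suffices h : proj k A B M o n x y ∘ₗ incl k A B M n x' y' =
      if ∀ t ≤ n, x' t = x t ∧ y' t = y t then LinearMap.id else 0 by
    rw [← LinearMap.comp_apply, h]; split_ifs <;> rfl
  refine chain_ext fun m a b => ?_
  rw [LinearMap.comp_apply, incl_pure]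
  simp only [proj, pureChain, TensorProduct.map_tmul, PiTensorProduct.map_tprod,
    entryM_singleM, ofScalar_toScalar, Matrix.entryLinearMap_apply, Matrix.single_apply]
  split_ifs with h h0 h0
  · rw [LinearMap.id_apply]
    congr 3
    funext j
    rw [if_pos (h0 _ j.isLt)]
  -- The indices agree at place `0` but not at some place `t`; so `t` is positive and the
  -- corresponding diagonal factor is zero.
  · obtain ⟨t, ht, hne⟩ : ∃ t, t ≤ n ∧ ¬ (x' t = x t ∧ y' t = y t) := by
      by_contra hcon
      exact h0 fun t ht => by_contra fun hne => hcon ⟨t, ht, hne⟩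
    rcases t with _ | t
    · exact absurd h hne
    · rw [MultilinearMap.map_coord_zero _ ⟨t, ht⟩ (if_neg hne)]
      simp
  · exact absurd (h0 0 (Nat.zero_le _)) h
  · simp

/-- The images of the inclusions span: every matrix is a sum of matrix units, and every scalar
matrix comes from `B`. The index `o` only fills the unused tails of the sequences. -/
theorem incl_ext {n : ℕ} {X : Type*} [AddCommGroup X] [Module k X]
    {f g : Chain k (Matrix (Fin N) (Fin N) A) (ScalarMatrices k B N) (MatrixBimodule N M) n →ₗ[k] X}
    (o : Fin N) (h : ∀ x y c, f (incl k A B M n x y c) = g (incl k A B M n x y c)) : f = g := by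
  refine chain_ext fun m a b => ?_
  choose b' hb' using fun r => toScalar_surjective (k := k) (b r)
  obtain rfl : (fun r => toScalar k B N (b' r)) = b := funext hb'
  have hm : m = ∑ z : Fin N × Fin N, singleM k M z.1 z.2 (m z.1 z.2) := sum_singleM m
  -- Multilinearity expands the tensor as a sum over all choices `w` of one matrix unit in each
  -- factor.
  have ha : PiTensorProduct.tprod k a = ∑ w : Fin n → Fin N × Fin N, PiTensorProduct.tprod k
      (fun i => Matrix.single (w i).1 (w i).2 (a i (w i).1 (w i).2)) := by
    rw [← MultilinearMap.map_sum (g := fun i (z : Fin N × Fin N) =>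
      Matrix.single z.1 z.2 (a i z.1 z.2))]
    congr 1
    funext i
    rw [Fintype.sum_prod_type]
    exact Matrix.matrix_eq_sum_single (a i)
  -- Place `0` of the sequences carries the indices `z` of the coefficient, and place `t + 1`
  -- carries `w t`.
  have key : pureChain k m a (fun r => toScalar k B N (b' r)) =
      ∑ z : Fin N × Fin N, ∑ w : Fin n → Fin N × Fin N, incl k A B M n
        (fun t => if t = 0 then z.1 else if h : t - 1 < n then (w ⟨t - 1, h⟩).1 else o)
        (fun t => if t = 0 then z.2 else if h : t - 1 < n then (w ⟨t - 1, h⟩).2 else o)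
        (pureChain k (m z.1 z.2) (fun i => a i (w i).1 (w i).2) b') := by
    simp only [incl_pure]
    rw [pureChain, ha]
    conv_lhs => rw [hm]
    simp only [TensorProduct.sum_tmul, TensorProduct.tmul_sum]
    rw [Finset.sum_comm]
    refine Finset.sum_congr rfl fun z _ => Finset.sum_congr rfl fun w _ => ?_
    simp [pureChain]
  simp only [key, map_sum, h]

variable (k A B M) in
/-- The linear map with prescribed restrictions along the inclusions `incl`. -/
def desc (o : Fin N) (n : ℕ) {X : Type*} [AddCommGroup X] [Module k X]
    (F : (ℕ → Fin N) → (ℕ → Fin N) → Chain k A B M n →ₗ[k] X) :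
    Chain k (Matrix (Fin N) (Fin N) A) (ScalarMatrices k B N) (MatrixBimodule N M) n →ₗ[k] X :=
  ∑ z : (Fin (n + 1) → Fin N) × (Fin (n + 1) → Fin N),
    F (fun t => if h : t < n + 1 then z.1 ⟨t, h⟩ else o)
        (fun t => if h : t < n + 1 then z.2 ⟨t, h⟩ else o) ∘ₗ
      proj k A B M o n (fun t => if h : t < n + 1 then z.1 ⟨t, h⟩ else o)
        (fun t => if h : t < n + 1 then z.2 ⟨t, h⟩ else o)

/-- By `proj_incl` only the summand indexed by the first `n + 1` terms of `x` and `y` survives. That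
summand uses these terms continued by `o`; `hF` says that the continuation does not affect `F`. -/
theorem desc_incl (o : Fin N) (n : ℕ) {X : Type*} [AddCommGroup X] [Module k X]
    (F : (ℕ → Fin N) → (ℕ → Fin N) → Chain k A B M n →ₗ[k] X)
    (hF : ∀ x y x' y', (∀ t ≤ n, x t = x' t) → (∀ t ≤ n, y t = y' t) → F x y = F x' y')
    (x y : ℕ → Fin N) (c : Chain k A B M n) :
    desc k A B M o n F (incl k A B M n x y c) = F x y c := by
  rw [desc, LinearMap.sum_apply]
  refine (Finset.sum_eq_single ((fun t => x t, fun t => y t) : (Fin (n + 1) → Fin N) ×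
    (Fin (n + 1) → Fin N)) ?_ ?_).trans ?_
  rotate_left 2
  · rw [LinearMap.comp_apply, proj_incl, if_pos]
    · refine LinearMap.congr_fun (hF _ _ _ _ ?_ ?_) c <;> intro t ht <;>
        exact dif_pos (Nat.lt_succ_of_le ht)
    · intro t ht
      rw [dif_pos (Nat.lt_succ_of_le ht), dif_pos (Nat.lt_succ_of_le ht)]
      exact ⟨rfl, rfl⟩
  · intro z _ hz
    rw [LinearMap.comp_apply, proj_incl, if_neg, map_zero]
    intro h
    refine hz (Prod.ext (funext fun t => ?_) (funext fun t => ?_))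
    · have := (h t (Nat.le_of_lt_succ t.isLt)).1
      rw [dif_pos t.isLt] at this
      exact this.symm
    · have := (h t (Nat.le_of_lt_succ t.isLt)).2
      rw [dif_pos t.isLt] at this
      exact this.symm
  · simp

end ElementaryMatrices

/-! ### Faces of tensors of matrix units. -/

section MatrixFaces

variable {k A B : Type*} [CommRing k] [Ring A] [CommRing B] [Algebra k A] [Algebra k B]
variable (T : AlgTriple k A B)
variable {M : Type*} [AddCommGroup M] [Module k M] [Module A M] [Module Aᵐᵒᵖ M]
  [IsScalarTower k A M] [IsScalarTower k Aᵐᵒᵖ M]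
variable {N : ℕ}

theorem single_smul_singleM (r s i j : Fin N) (a : A) (m : M) :
    (Matrix.single r s a) • singleM k M i j m =
      if s = i then singleM k M r j (a • m) else 0 := by
  funext u v
  rw [MatrixBimodule.smul_apply]
  have : ∀ l, Matrix.single r s a u l • singleM k M i j m l v =
      if l = s then (if r = u ∧ s = i ∧ j = v then a • m else 0) else 0 := by
    intro l
    rw [Matrix.single_apply, singleM_apply]
    by_cases h : l = s
    · subst h
      by_cases h1 : r = u <;> by_cases h2 : l = i <;> by_cases h3 : j = v <;>
        (simp [h1, h2, h3, eq_comm]; try aesop)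
    · simp [h, Ne.symm h, eq_comm]
  simp only [this, Finset.sum_ite_eq', Finset.mem_univ, if_true]
  by_cases h : s = i
  · simp [h, singleM_apply]
  · rw [if_neg h, if_neg (by tauto)]; rfl

theorem op_single_smul_singleM (r s i j : Fin N) (a : A) (m : M) :
    op (Matrix.single r s a) • singleM k M i j m =
      if j = r then singleM k M i s (op a • m) else 0 := by
  funext u v
  rw [MatrixBimodule.op_smul_apply]
  have : ∀ l, op (Matrix.single r s a l v) • singleM k M i j m u l =
      if l = r then (if i = u ∧ j = r ∧ s = v then op a • m else 0) else 0 := by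
    intro l
    rw [Matrix.single_apply, singleM_apply]
    by_cases h : l = r
    · subst h
      by_cases h1 : i = u <;> by_cases h2 : j = l <;> by_cases h3 : s = v <;>
        simp [h1, h2, h3]
    · simp [h, Ne.symm h]
  simp only [this, Finset.sum_ite_eq', Finset.mem_univ, if_true]
  by_cases h : j = r
  · simp [h, singleM_apply]
  · rw [if_neg h, if_neg (by tauto)]; rfl

theorem ε_toScalar (b : B) :
    (T.matrix N).ε (toScalar k B N b) = Matrix.diagonal fun _ => T.ε b :=
  T.ε_matrix N b

/-- A constant diagonal matrix preserves the place of a matrix unit. This is why the array over `B`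
never interferes with the matrix indices. -/
theorem single_mul_ε_toScalar (r s : Fin N) (a : A) (b : B) :
    Matrix.single r s a * (T.matrix N).ε (toScalar k B N b) = Matrix.single r s (a * T.ε b) := by
  rw [ε_toScalar]
  ext i j
  rw [Matrix.mul_diagonal, Matrix.single_apply, Matrix.single_apply, ite_mul, zero_mul]

theorem fiberProd_toScalar {ι κ : Type*} [Fintype ι] [DecidableEq κ] (τ : ι → κ) (b : ι → B)
    (s : κ) : fiberProd τ (fun r => toScalar k B N (b r)) s = toScalar k B N (fiberProd τ b s) := by
  simp only [fiberProd, map_prod]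

/-- The sequence `x` without its term of index `i`. -/
def del {X : Type*} (i : ℕ) (x : ℕ → X) (t : ℕ) : X := if t < i then x t else x (t + 1)

theorem pureChain_eq_zero {M : Type*} [AddCommGroup M] [Module k M] {n : ℕ} (m : M) {a : Fin n → A}
    (b : Pairs n → B) (i : Fin n) (h : a i = 0) : pureChain k m a b = 0 := by
  rw [pureChain, MultilinearMap.map_coord_zero _ i h]
  simp

/-- The product `E_{x₀y₀} E_{x₁y₁}` is `E_{x₀y₁}` if `y₀ = x₁` and zero otherwise, so the two inner
indices `y₀` and `x₁` disappear. -/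
theorem faceFirst_incl (n : ℕ) (x y : ℕ → Fin N) (c : Chain k A B M (n + 1)) :
    (T.matrix N).faceFirst (MatrixBimodule N M) n (incl k A B M (n + 1) x y c) =
      if y 0 = x 1 then incl k A B M n (del 1 x) (del 0 y) (T.faceFirst M n c) else 0 := by
  suffices h : (T.matrix N).faceFirst (MatrixBimodule N M) n ∘ₗ incl k A B M (n + 1) x y =
      if y 0 = x 1 then incl k A B M n (del 1 x) (del 0 y) ∘ₗ T.faceFirst M n else 0 by
    rw [← LinearMap.comp_apply, h]; split_ifs <;> rfl
  refine chain_ext fun m a b => ?_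
  rw [LinearMap.comp_apply, incl_pure, faceFirst_pure, fiberProd_toScalar, single_mul_ε_toScalar,
    op_single_smul_singleM]
  by_cases h : y 0 = x 1
  · rw [if_pos (by simpa using h), if_pos h, LinearMap.comp_apply, faceFirst_pure, incl_pure]
    refine pure_congr ?_ ?_ ?_
    · simp [del]
    · funext j
      simp [del]
    · funext r
      exact fiberProd_toScalar _ _ _
  · rw [if_neg (by simpa using h), if_neg h]
    simp [pureChain]

/-- The last entry multiplies the coefficient from the left, so its row index replaces `x₀`. Its
column index `y (n + 1)` needs no deletion, being out of range in degree `n`. -/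
theorem faceLast_incl (n : ℕ) (x y : ℕ → Fin N) (c : Chain k A B M (n + 1)) :
    (T.matrix N).faceLast (MatrixBimodule N M) n (incl k A B M (n + 1) x y c) =
      if y (n + 1) = x 0 then
        incl k A B M n (Function.update x 0 (x (n + 1))) y (T.faceLast M n c) else 0 := by
  suffices h : (T.matrix N).faceLast (MatrixBimodule N M) n ∘ₗ incl k A B M (n + 1) x y =
      if y (n + 1) = x 0 then
        incl k A B M n (Function.update x 0 (x (n + 1))) y ∘ₗ T.faceLast M n else 0 by
    rw [← LinearMap.comp_apply, h]; split_ifs <;> rfl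
  refine chain_ext fun m a b => ?_
  rw [LinearMap.comp_apply, incl_pure, faceLast_pure, fiberProd_toScalar, single_mul_ε_toScalar,
    single_smul_singleM]
  by_cases h : y (n + 1) = x 0
  · rw [if_pos (by simpa using h), if_pos h, LinearMap.comp_apply, faceLast_pure, incl_pure]
    refine pure_congr ?_ ?_ ?_
    · simp
    · funext j
      simp
    · funext r
      exact fiberProd_toScalar _ _ _
  · rw [if_neg (by simpa using h), if_neg h]
    simp [pureChain]

theorem faceMid_incl {n : ℕ} (p : Fin n) (x y : ℕ → Fin N) (c : Chain k A B M (n + 1)) :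
    (T.matrix N).faceMid (MatrixBimodule N M) p (incl k A B M (n + 1) x y c) =
      if y (p + 1) = x (p + 2) then
        incl k A B M n (del (p + 2) x) (del (p + 1) y) (T.faceMid M p c) else 0 := by
  suffices h : (T.matrix N).faceMid (MatrixBimodule N M) p ∘ₗ incl k A B M (n + 1) x y =
      if y (p + 1) = x (p + 2) then
        incl k A B M n (del (p + 2) x) (del (p + 1) y) ∘ₗ T.faceMid M p else 0 by
    rw [← LinearMap.comp_apply, h]; split_ifs <;> rfl
  refine chain_ext fun m a b => ?_
  rw [LinearMap.comp_apply, incl_pure, faceMid_pure, fiberProd_toScalar]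
  by_cases h : y (p + 1) = x (p + 2)
  · rw [if_pos h, LinearMap.comp_apply, faceMid_pure, incl_pure]
    refine pure_congr ?_ ?_ ?_
    · simp [del]
    · funext j
      rcases lt_trichotomy j.val p.val with hj | hj | hj
      · rw [mergeA_of_lt _ _ _ hj, mergeA_of_lt _ _ _ hj]
        simp [del, hj, show j.val < p.val + 1 by omega]
      · obtain rfl := Fin.ext hj
        rw [mergeA_self, mergeA_self, single_mul_ε_toScalar]
        simp only [Fin.val_castSucc, Fin.val_succ, h]
        rw [Matrix.single_mul_single_same]
        simp [del]
      · rw [mergeA_of_gt _ _ _ hj, mergeA_of_gt _ _ _ hj]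
        simp [del, show ¬ j.val < p.val by omega, show ¬ j.val < p.val + 1 by omega]
    · funext r
      exact fiberProd_toScalar _ _ _
  -- If the inner indices differ, the merged diagonal entry is zero, and so is the whole tensor.
  · rw [if_neg h]
    refine pureChain_eq_zero _ _ p ?_
    rw [mergeA_self, single_mul_ε_toScalar]
    exact Matrix.single_mul_single_of_ne (h := by simpa using h) ..

/-- With the coefficient counted as place `0`, the first face and the inner faces obey one formula;
only the last face, which wraps around, differs. -/
theorem natFace_incl {n i : ℕ} (hi : i ≤ n) (x y : ℕ → Fin N) (c : Chain k A B M (n + 1)) :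
    (T.matrix N).natFace (MatrixBimodule N M) n i (incl k A B M (n + 1) x y c) =
      if y i = x (i + 1) then
        incl k A B M n (del (i + 1) x) (del i y) (T.natFace M n i c) else 0 := by
  rcases i with _ | p
  · rw [natFace_zero, natFace_zero, faceFirst_incl]
  · rw [natFace_mid _ _ hi, natFace_mid _ _ hi, faceMid_incl]

theorem natFace_last_incl (n : ℕ) (x y : ℕ → Fin N) (c : Chain k A B M (n + 1)) :
    (T.matrix N).natFace (MatrixBimodule N M) n (n + 1) (incl k A B M (n + 1) x y c) =
      if y (n + 1) = x 0 then incl k A B M n (Function.update x 0 (x (n + 1))) y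
        (T.natFace M n (n + 1) c) else 0 := by
  rw [natFace_last, natFace_last, faceLast_incl]

end MatrixFaces

end AlgTriple

/-! ### The trace, the inclusion at `o`, and the homotopy between them. -/

namespace AlgTriple

section MatrixHomotopy

variable {k A B : Type*} [CommRing k] [Ring A] [CommRing B] [Algebra k A] [Algebra k B]
variable (T : AlgTriple k A B)
variable (M : Type*) [AddCommGroup M] [Module k M]
variable {N : ℕ} (o : Fin N)

open Classical in
variable (k A B) in
/-- The generalized trace from chains over matrices to chains over `(A, B, ε)`. -/
def trace (n : ℕ) :
    Chain k (Matrix (Fin N) (Fin N) A) (ScalarMatrices k B N) (MatrixBimodule N M) n →ₗ[k]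
      Chain k A B M n :=
  desc k A B M o n fun x y =>
    if (∀ t < n, y t = x (t + 1)) ∧ y n = x 0 then LinearMap.id else 0

open Classical in
-- The condition says that consecutive indices match cyclically, which is when the product of the
-- matrix units has nonzero trace.
theorem trace_incl (n : ℕ) (x y : ℕ → Fin N) (c : Chain k A B M n) :
    trace k A B M o n (incl k A B M n x y c) =
      if (∀ t < n, y t = x (t + 1)) ∧ y n = x 0 then c else 0 := by
  rw [trace, desc_incl]
  · split_ifs <;> rfl
  · intro x y x' y' hx hy
    refine if_congr ?_ rfl rfl
    rw [hy n le_rfl, hx 0 (Nat.zero_le n)]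
    refine and_congr_left fun _ => forall₂_congr fun t ht => ?_
    rw [hy t ht.le, hx (t + 1) ht]

/-- The row indices after inserting `E_{o, y j}(1)` at position `j + 1`. -/
def rowIdx (j : ℕ) (x : ℕ → Fin N) (t : ℕ) : Fin N :=
  if t = 0 then x 0 else if t ≤ j + 1 then o else x (t - 1)

/-- The column indices after inserting `E_{o, y j}(1)` at position `j + 1`. -/
def colIdx (j : ℕ) (y : ℕ → Fin N) (t : ℕ) : Fin N :=
  if t ≤ j then o else y (t - 1)

open Classical in
variable (k A B) in
/-- The presimplicial homotopy between the identity and the trace followed by the inclusion. -/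
def preHomotopy (n j : ℕ) :
    Chain k (Matrix (Fin N) (Fin N) A) (ScalarMatrices k B N) (MatrixBimodule N M) n →ₗ[k]
      Chain k (Matrix (Fin N) (Fin N) A) (ScalarMatrices k B N) (MatrixBimodule N M) (n + 1) :=
  desc k A B M o n fun x y =>
    if ∀ t < j, y t = x (t + 1) then
      incl k A B M (n + 1) (rowIdx o j x) (colIdx o j y) ∘ₗ natDegen k A B M n j
    else 0

open Classical in
-- The resulting matrix units are `E_{x₀o}`, then `j` copies of `E_{oo}`, then `E_{o y_j}` around
-- the inserted `1`, then the original ones from place `j + 1` on. The indices `y_t` and `x_{t+1}`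
-- with `t < j` are forgotten, so they are required to match.
theorem preHomotopy_incl {n j : ℕ} (hj : j ≤ n) (x y : ℕ → Fin N) (c : Chain k A B M n) :
    preHomotopy k A B M o n j (incl k A B M n x y c) =
      if ∀ t < j, y t = x (t + 1) then
        incl k A B M (n + 1) (rowIdx o j x) (colIdx o j y) (natDegen k A B M n j c) else 0 := by
  rw [preHomotopy, desc_incl]
  · split_ifs <;> rfl
  · intro x y x' y' hx hy
    refine if_congr (forall₂_congr fun t ht => ?_) ?_ rfl
    · rw [hy t (by omega), hx (t + 1) (by omega)]
    · rw [incl_congr]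
      · intro t ht
        simp only [rowIdx]
        split_ifs
        exacts [hx 0 (Nat.zero_le n), rfl, hx _ (by omega)]
      · intro t ht
        simp only [colIdx]
        split_ifs
        exacts [rfl, hy _ (by omega)]

variable [Module A M] [Module Aᵐᵒᵖ M] [IsScalarTower k A M] [IsScalarTower k Aᵐᵒᵖ M]

/-- A cycle of `n + 2` indices consists of the match contracted by the face and a cycle formed by
the remaining ones. For the last face the contracted match is the one closing the cycle. -/
theorem trace_natFace {n i : ℕ} (hi : i ≤ n + 1)
    (c : Chain k (Matrix (Fin N) (Fin N) A) (ScalarMatrices k B N) (MatrixBimodule N M) (n + 1)) :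
    trace k A B M o n ((T.matrix N).natFace (MatrixBimodule N M) n i c) =
      T.natFace M n i (trace k A B M o (n + 1) c) := by
  refine LinearMap.congr_fun (f := trace k A B M o n ∘ₗ (T.matrix N).natFace _ n i)
    (g := T.natFace M n i ∘ₗ trace k A B M o (n + 1)) (incl_ext o fun x y c => ?_) c
  rw [LinearMap.comp_apply, LinearMap.comp_apply, trace_incl]
  rcases hi.lt_or_eq with h | rfl
  · rw [natFace_incl _ (Nat.le_of_lt_succ h), apply_ite (trace k A B M o n),
      apply_ite (T.natFace M n i), map_zero, map_zero, trace_incl, ← ite_and]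
    refine if_congr ?_ rfl rfl
    constructor
    · rintro ⟨h1, h2, h3⟩
      refine ⟨fun t ht => ?_, ?_⟩
      · rcases lt_trichotomy t i with hti | rfl | hti
        · have := h2 t (by omega)
          simpa [del, hti, show t < i + 1 by omega] using this
        · exact h1
        -- Beyond the contracted place the sequences are shifted, so the match at `t` is read off at
        -- `t - 1` after deletion.
        · obtain ⟨s, rfl⟩ : ∃ s, t = s + 1 := ⟨t - 1, by omega⟩
          have := h2 s (by omega)
          simpa [del, show ¬ s < i by omega, show ¬ s + 1 < i + 1 by omega] using this
      · simpa [del, show ¬ n < i by omega] using h3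
    · rintro ⟨h1, h2⟩
      refine ⟨h1 i h, fun t ht => ?_, ?_⟩
      · simp only [del, Nat.add_lt_add_iff_right]
        split_ifs
        exacts [h1 t (by omega), h1 (t + 1) (by omega)]
      · simpa [del, show ¬ n < i by omega] using h2
  · rw [natFace_last_incl, apply_ite (trace k A B M o n),
      apply_ite (T.natFace M n (n + 1)), map_zero, map_zero, trace_incl, ← ite_and]
    refine if_congr ?_ rfl rfl
    constructor
    · rintro ⟨h1, h2, h3⟩
      refine ⟨fun t ht => ?_, h1⟩
      rcases (Nat.le_of_lt_succ ht).lt_or_eq with htn | rfl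
      · simpa using h2 t htn
      · simpa using h3
    · rintro ⟨h1, h2⟩
      refine ⟨h2, fun t ht => ?_, ?_⟩
      · simpa using h1 t (by omega)
      · simpa using h1 n (by omega)

theorem trace_boundary (n : ℕ) : trace k A B M o n ∘ₗ (T.matrix N).boundary (MatrixBimodule N M) n =
    T.boundary M n ∘ₗ trace k A B M o (n + 1) := by
  refine LinearMap.ext fun c => ?_
  simp only [LinearMap.comp_apply, boundary_apply, map_sum, map_zsmul]
  refine Finset.sum_congr rfl fun i hi => ?_
  rw [trace_natFace T M o (Nat.le_of_lt_succ (Finset.mem_range.mp hi))]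

/-- Constant sequences always match and stay constant under deletion. -/
theorem natFace_incl_const {n i : ℕ} (hi : i ≤ n + 1) (c : Chain k A B M (n + 1)) :
    (T.matrix N).natFace (MatrixBimodule N M) n i
        (incl k A B M (n + 1) (fun _ => o) (fun _ => o) c) =
      incl k A B M n (fun _ => o) (fun _ => o) (T.natFace M n i c) := by
  rcases hi.lt_or_eq with h | rfl
  · rw [natFace_incl _ (Nat.le_of_lt_succ h), if_pos rfl]
    rw [incl_congr (x' := fun _ => o) (y' := fun _ => o)] <;> simp [del]
  · rw [natFace_last_incl, if_pos rfl]
    rw [incl_congr (x' := fun _ => o) (y' := fun _ => o)]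
    · intro t _
      simp [Function.update_apply]
    · simp

theorem incl_boundary (n : ℕ) : incl k A B M n (fun _ => o) (fun _ => o) ∘ₗ T.boundary M n =
    (T.matrix N).boundary (MatrixBimodule N M) n ∘ₗ
      incl k A B M (n + 1) (fun _ => o) (fun _ => o) := by
  refine LinearMap.ext fun c => ?_
  simp only [LinearMap.comp_apply, boundary_apply, map_sum, map_zsmul]
  refine Finset.sum_congr rfl fun i hi => ?_
  rw [natFace_incl_const T M o (Nat.le_of_lt_succ (Finset.mem_range.mp hi))]

/-- This is `d_i h_{j+1} = h_j d_i` for `i ≤ j`. On the left the homotopy demands `y_i = x_{i+1}`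
and the face contracts two indices `o`; on the right the face makes that demand. -/
theorem natFace_preHomotopy_of_le {n i j : ℕ} (h : i ≤ j) (hj : j ≤ n)
    (c : Chain k (Matrix (Fin N) (Fin N) A) (ScalarMatrices k B N) (MatrixBimodule N M) (n + 1)) :
    (T.matrix N).natFace (MatrixBimodule N M) (n + 1) i (preHomotopy k A B M o (n + 1) (j + 1) c) =
      preHomotopy k A B M o n j ((T.matrix N).natFace (MatrixBimodule N M) n i c) := by
  refine LinearMap.congr_fun
    (f := (T.matrix N).natFace _ (n + 1) i ∘ₗ preHomotopy k A B M o (n + 1) (j + 1))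
    (g := preHomotopy k A B M o n j ∘ₗ (T.matrix N).natFace _ n i) (incl_ext o fun x y c => ?_) c
  rw [LinearMap.comp_apply, LinearMap.comp_apply, natFace_incl _ (by omega),
    preHomotopy_incl _ _ (by omega), apply_ite (preHomotopy k A B M o n j),
    apply_ite ((T.matrix N).natFace _ (n + 1) i), map_zero, map_zero,
    natFace_incl _ (by omega), preHomotopy_incl _ _ hj, ← ite_and, ← ite_and,
    natFace_natDegen_of_le T M h hj]
  refine if_congr ?_ ?_ rfl
  · rw [and_iff_left (by simp [rowIdx, colIdx, show i ≤ j + 1 by omega])]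
    constructor
    · intro h1
      refine ⟨h1 i (by omega), fun t ht => ?_⟩
      simp only [del, Nat.add_lt_add_iff_right]
      split_ifs
      exacts [h1 t (by omega), h1 (t + 1) (by omega)]
    · rintro ⟨h1, h2⟩ t ht
      rcases lt_trichotomy t i with hti | rfl | hti
      · have := h2 t (by omega)
        simpa [del, hti, show t < i + 1 by omega] using this
      · exact h1
      · obtain ⟨s, rfl⟩ : ∃ s, t = s + 1 := ⟨t - 1, by omega⟩
        have := h2 s (by omega)
        simpa [del, show ¬ s < i by omega, show ¬ s + 1 < i + 1 by omega] using this
  · rw [incl_congr] <;> intro t _ <;> simp only [rowIdx, colIdx, del] <;> split_ifs <;>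
      first | rfl | (exfalso; omega) | (congr 1; omega)

/-- This is `d_{i+1} h_j = h_j d_i` for `j < i`. The face contracts indices to the right of the
inserted unit, where `h_j` has only shifted them; the last face contracts `y_{n+1}` with `x₀`, both
kept by `h_j`. -/
theorem natFace_preHomotopy_of_lt {n i j : ℕ} (h : j < i) (hi : i ≤ n + 1)
    (c : Chain k (Matrix (Fin N) (Fin N) A) (ScalarMatrices k B N) (MatrixBimodule N M) (n + 1)) :
    (T.matrix N).natFace (MatrixBimodule N M) (n + 1) (i + 1) (preHomotopy k A B M o (n + 1) j c) =
      preHomotopy k A B M o n j ((T.matrix N).natFace (MatrixBimodule N M) n i c) := by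
  refine LinearMap.congr_fun
    (f := (T.matrix N).natFace _ (n + 1) (i + 1) ∘ₗ preHomotopy k A B M o (n + 1) j)
    (g := preHomotopy k A B M o n j ∘ₗ (T.matrix N).natFace _ n i) (incl_ext o fun x y c => ?_) c
  rw [LinearMap.comp_apply, LinearMap.comp_apply, preHomotopy_incl _ _ (by omega),
    apply_ite ((T.matrix N).natFace _ (n + 1) (i + 1)), map_zero]
  rcases hi.lt_or_eq with h' | rfl
  · rw [natFace_incl _ (by omega), natFace_incl _ (by omega),
      apply_ite (preHomotopy k A B M o n j), map_zero,
      preHomotopy_incl _ _ (by omega), ← ite_and, ← ite_and, natFace_natDegen_of_lt T M h hi]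
    refine if_congr ?_ ?_ rfl
    · rw [and_comm]
      refine and_congr ?_ (forall₂_congr fun t ht => ?_)
      · simp [rowIdx, colIdx, show ¬ i + 1 ≤ j by omega, show ¬ i ≤ j by omega]
      · simp [del, show t < i by omega]
    · rw [incl_congr] <;> intro t _ <;> simp only [rowIdx, colIdx, del] <;> split_ifs <;>
        first | rfl | (exfalso; omega) | (congr 1; omega)
  · rw [natFace_last_incl, natFace_last_incl,
      apply_ite (preHomotopy k A B M o n j), map_zero,
      preHomotopy_incl _ _ (by omega), ← ite_and, ← ite_and, natFace_natDegen_of_lt T M h hi]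
    refine if_congr ?_ ?_ rfl
    · rw [and_comm]
      refine and_congr ?_ (forall₂_congr fun t ht => ?_)
      · simp [rowIdx, colIdx, show ¬ n + 1 + 1 ≤ j by omega]
      · simp
    · rw [incl_congr] <;> intro t _ <;> simp only [rowIdx, colIdx, Function.update_apply]
      split_ifs <;> first | rfl | (exfalso; omega)

/-- Both sides contain `E_{o y_{j+1}}(a_j)`: on the left as `E_{oo}(a_j) E_{o y_{j+1}}(1)`, on the
right as `E_{o y_j}(1) E_{x_{j+1}y_{j+1}}(a_j)`. The match `y_j = x_{j+1}` is imposed by the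
homotopy on the left and by the face on the right. -/
theorem natFace_preHomotopy_diag {n j : ℕ} (hj : j < n)
    (c : Chain k (Matrix (Fin N) (Fin N) A) (ScalarMatrices k B N) (MatrixBimodule N M) n) :
    (T.matrix N).natFace (MatrixBimodule N M) n (j + 1) (preHomotopy k A B M o n (j + 1) c) =
      (T.matrix N).natFace (MatrixBimodule N M) n (j + 1) (preHomotopy k A B M o n j c) := by
  refine LinearMap.congr_fun
    (f := (T.matrix N).natFace _ n (j + 1) ∘ₗ preHomotopy k A B M o n (j + 1))
    (g := (T.matrix N).natFace _ n (j + 1) ∘ₗ preHomotopy k A B M o n j)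
    (incl_ext o fun x y c => ?_) c
  rw [LinearMap.comp_apply, LinearMap.comp_apply, preHomotopy_incl _ _ (by omega),
    preHomotopy_incl _ _ (by omega), apply_ite ((T.matrix N).natFace _ n (j + 1)),
    apply_ite ((T.matrix N).natFace _ n (j + 1)), map_zero, natFace_incl _ (by omega),
    natFace_incl _ (by omega), ← ite_and, ← ite_and, natFace_natDegen_self _ _ (by omega),
    natFace_succ_natDegen _ _ (by omega)]
  refine if_congr ?_ ?_ rfl
  · rw [and_iff_left (by simp [rowIdx, colIdx])]
    simp only [rowIdx, colIdx, Nat.lt_succ_iff_lt_or_eq, or_imp, forall_and, forall_eq]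
    refine and_congr_right fun _ => ?_
    simp
  · rw [incl_congr] <;> intro t _ <;> simp only [rowIdx, colIdx, del] <;> split_ifs <;>
      first | rfl | (exfalso; omega)

/-- `h₀` imposes no condition, and `E_{x₀o}(m) E_{o y₀}(1) = E_{x₀y₀}(m)`. -/
theorem natFace_preHomotopy_first (n : ℕ)
    (c : Chain k (Matrix (Fin N) (Fin N) A) (ScalarMatrices k B N) (MatrixBimodule N M) n) :
    (T.matrix N).natFace (MatrixBimodule N M) n 0 (preHomotopy k A B M o n 0 c) = c := by
  refine LinearMap.congr_fun (f := (T.matrix N).natFace _ n 0 ∘ₗ preHomotopy k A B M o n 0)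
    (g := LinearMap.id) (incl_ext o fun x y c => ?_) c
  rw [LinearMap.comp_apply, preHomotopy_incl _ _ (Nat.zero_le n), if_pos (by simp),
    natFace_incl _ (Nat.zero_le n), if_pos (by simp [rowIdx, colIdx]),
    natFace_natDegen_self _ _ (Nat.zero_le n), LinearMap.id_apply]
  rw [incl_congr] <;> intro t _ <;> simp only [rowIdx, colIdx, del] <;> split_ifs <;>
    first | rfl | (exfalso; omega) | (congr 1; omega)

/-- Here `E_{o yₙ}(1) E_{x₀o}(m)` is `E_{oo}(m)` if `yₙ = x₀` and zero otherwise. Together with the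
matches required by `hₙ` this is the cycle condition of the trace, and every remaining index is `o`.
-/
theorem natFace_preHomotopy_last (n : ℕ)
    (c : Chain k (Matrix (Fin N) (Fin N) A) (ScalarMatrices k B N) (MatrixBimodule N M) n) :
    (T.matrix N).natFace (MatrixBimodule N M) n (n + 1) (preHomotopy k A B M o n n c) =
      incl k A B M n (fun _ => o) (fun _ => o) (trace k A B M o n c) := by
  refine LinearMap.congr_fun (f := (T.matrix N).natFace _ n (n + 1) ∘ₗ preHomotopy k A B M o n n)
    (g := incl k A B M n (fun _ => o) (fun _ => o) ∘ₗ trace k A B M o n)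
    (incl_ext o fun x y c => ?_) c
  rw [LinearMap.comp_apply, LinearMap.comp_apply, preHomotopy_incl _ _ le_rfl, trace_incl,
    apply_ite ((T.matrix N).natFace _ n (n + 1)), apply_ite (incl k A B M n _ _), map_zero,
    map_zero, natFace_last_incl, ← ite_and, natFace_succ_natDegen _ _ le_rfl]
  refine if_congr (and_congr_right fun _ => ?_) ?_ rfl
  · simp [rowIdx, colIdx]
  · rw [incl_congr] <;> intro t _ <;> simp only [rowIdx, colIdx, Function.update_apply] <;>
      split_ifs <;> first | rfl | (exfalso; omega)

variable (k A B) in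
/-- The alternating sum of the maps `preHomotopy`. -/
def homotopySum (n : ℕ) :
    Chain k (Matrix (Fin N) (Fin N) A) (ScalarMatrices k B N) (MatrixBimodule N M) n →ₗ[k]
      Chain k (Matrix (Fin N) (Fin N) A) (ScalarMatrices k B N) (MatrixBimodule N M) (n + 1) :=
  ∑ j ∈ Finset.range (n + 1), (-1 : ℤ) ^ j • preHomotopy k A B M o n j

theorem homotopySum_apply (n : ℕ)
    (c : Chain k (Matrix (Fin N) (Fin N) A) (ScalarMatrices k B N) (MatrixBimodule N M) n) :
    homotopySum k A B M o n c =
      ∑ j ∈ Finset.range (n + 1), (-1 : ℤ) ^ j • preHomotopy k A B M o n j c :=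
  LinearMap.sum_zsmul_apply _ _ _ c

theorem boundary_homotopySum (n : ℕ)
    (c : Chain k (Matrix (Fin N) (Fin N) A) (ScalarMatrices k B N) (MatrixBimodule N M) n) :
    (T.matrix N).boundary (MatrixBimodule N M) n (homotopySum k A B M o n c) =
      ∑ i ∈ Finset.range (n + 2), ∑ j ∈ Finset.range (n + 1), (-1 : ℤ) ^ (i + j) •
        (T.matrix N).natFace (MatrixBimodule N M) n i (preHomotopy k A B M o n j c) := by
  rw [boundary_apply]
  simp only [homotopySum_apply, map_sum, map_zsmul]
  exact sum_zsmul_sum _ _ _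

theorem homotopySum_boundary (n : ℕ)
    (c : Chain k (Matrix (Fin N) (Fin N) A) (ScalarMatrices k B N) (MatrixBimodule N M) (n + 1)) :
    homotopySum k A B M o n ((T.matrix N).boundary (MatrixBimodule N M) n c) =
      ∑ i ∈ Finset.range (n + 2), ∑ j ∈ Finset.range (n + 1), (-1 : ℤ) ^ (i + j) •
        preHomotopy k A B M o n j ((T.matrix N).natFace (MatrixBimodule N M) n i c) := by
  simp only [boundary_apply, map_sum, map_zsmul]
  simp only [homotopySum_apply]
  exact sum_zsmul_sum _ _ _

theorem homotopySum_zero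
    (c : Chain k (Matrix (Fin N) (Fin N) A) (ScalarMatrices k B N) (MatrixBimodule N M) 0) :
    (T.matrix N).boundary (MatrixBimodule N M) 0 (homotopySum k A B M o 0 c) =
      c - incl k A B M 0 (fun _ => o) (fun _ => o) (trace k A B M o 0 c) := by
  -- For `q = 0` the exchange hypotheses are vacuous and no `K`-term occurs, so any `K` will do.
  have := presimplicial_homotopy_sum (fun i j => (T.matrix N).natFace (MatrixBimodule N M) 0 i
    (preHomotopy k A B M o 0 j c)) (fun _ _ => 0) 0 (by omega) (by omega) (by omega)
  simp only [Finset.range_zero, Finset.sum_empty, Finset.sum_const_zero, add_zero,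
    natFace_preHomotopy_first, natFace_preHomotopy_last] at this
  rw [boundary_homotopySum, this]

theorem homotopySum_succ (n : ℕ)
    (c : Chain k (Matrix (Fin N) (Fin N) A) (ScalarMatrices k B N) (MatrixBimodule N M) (n + 1)) :
    homotopySum k A B M o n ((T.matrix N).boundary (MatrixBimodule N M) n c) +
      (T.matrix N).boundary (MatrixBimodule N M) (n + 1) (homotopySum k A B M o (n + 1) c) =
      c - incl k A B M (n + 1) (fun _ => o) (fun _ => o) (trace k A B M o (n + 1) c) := by
  have := presimplicial_homotopy_sum (fun i j => (T.matrix N).natFace (MatrixBimodule N M) (n + 1) i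
    (preHomotopy k A B M o (n + 1) j c)) (fun i j => preHomotopy k A B M o n j
      ((T.matrix N).natFace (MatrixBimodule N M) n i c)) (n + 1)
    (fun i j h hj => natFace_preHomotopy_of_le T M o h (Nat.le_of_lt_succ hj) c)
    (fun j hj => natFace_preHomotopy_diag T M o hj c)
    (fun i j h hi => natFace_preHomotopy_of_lt T M o h hi c)
  simp only [natFace_preHomotopy_first, natFace_preHomotopy_last] at this
  rw [boundary_homotopySum, homotopySum_boundary, ← this]
  exact add_comm _ _

open CategoryTheory in
/-- The isomorphism from the homology of `(A, B, ε)` with coefficients in `M` to the homology of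
`(Mₙ(A), Iₙ(B), ε_*)` with coefficients in `Mₙ(M)` given by `E_{oo}` in all positions. -/
def homologyMatrixIso [SMulCommClass A Aᵐᵒᵖ M] (hM : T.IsSymmetric M) (i : ℕ) :
    T.homology M hM i ≅
      (T.matrix N).homology (MatrixBimodule N M) (T.isSymmetric_matrix hM N) i :=
  ModuleCat.homologyIsoOfHomotopy (T.boundary M) ((T.matrix N).boundary (MatrixBimodule N M))
    (T.boundary_comp_boundary M hM)
    ((T.matrix N).boundary_comp_boundary _ (T.isSymmetric_matrix hM N))
    (fun n => incl k A B M n (fun _ => o) (fun _ => o)) (trace k A B M o) (homotopySum k A B M o)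
    (incl_boundary T M o) (trace_boundary T M o)
    -- Trace after inclusion is the identity on the nose, since constant index sequences form a
    -- cycle.
    (fun n c => (trace_incl M o n _ _ c).trans (if_pos ⟨fun _ _ => rfl, rfl⟩))
    (homotopySum_zero T M o) (homotopySum_succ T M o) i

end MatrixHomotopy

end AlgTriple

/-! ### Universal property of the balanced tensor product. -/

namespace BalancedTensor

section

variable {R X Y Z : Type*} [Ring R] [AddCommGroup X] [AddCommGroup Y] [AddCommGroup Z]
  [Module Rᵐᵒᵖ X] [Module R Y]

theorem tmul_add (x : X) (y y' : Y) : tmul R x (y + y') = tmul R x y + tmul R x y' :=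
  congrArg QuotientAddGroup.mk (TensorProduct.tmul_add x y y')

theorem add_tmul (x x' : X) (y : Y) : tmul R (x + x') y = tmul R x y + tmul R x' y :=
  congrArg QuotientAddGroup.mk (TensorProduct.add_tmul x x' y)

variable (R X) in
/-- The additive map `x ↦ x ⊗ y`. -/
def tmulRight (y : Y) : X →+ BalancedTensor R X Y :=
  AddMonoidHom.mk' (fun x => tmul R x y) fun x x' => add_tmul x x' y

variable (R Y) in
/-- The additive map `y ↦ x ⊗ y`. -/
def tmulLeft (x : X) : Y →+ BalancedTensor R X Y :=
  AddMonoidHom.mk' (fun y => tmul R x y) fun y y' => tmul_add x y y'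

/-- The additive map induced by a balanced biadditive map. -/
def lift (φ : X →+ Y →+ Z) (h : ∀ x (r : R) y, φ (op r • x) y = φ x (r • y)) :
    BalancedTensor R X Y →+ Z :=
  QuotientAddGroup.lift _ (TensorProduct.liftAddHom φ fun r x y => by simp) (by
    rw [AddSubgroup.closure_le]
    rintro _ ⟨x, r, y, rfl⟩
    simp [h])

theorem hom_ext {φ ψ : BalancedTensor R X Y →+ Z}
    (h : ∀ x y, φ (tmul R x y) = ψ (tmul R x y)) : φ = ψ := by
  refine QuotientAddGroup.addMonoidHom_ext _ (AddMonoidHom.ext fun t => ?_)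
  induction t using TensorProduct.induction_on with
  | zero => simp
  | tmul x y => exact h x y
  | add t t' ht ht' => rw [map_add, map_add, ht, ht']

end

end BalancedTensor

/-! ### Row and column vectors and their two tensor products. -/

/-- Row vectors of length `N`, an `A`-`M_N(A)`-bimodule. -/
def RowVec (N : ℕ) (A : Type*) : Type _ := Fin N → A

/-- Column vectors of length `N`, an `M_N(A)`-`A`-bimodule. -/
def ColVec (N : ℕ) (A : Type*) : Type _ := Fin N → A

section Vectors

open Matrix

variable {N : ℕ} {A : Type*} [Ring A]

instance : AddCommGroup (RowVec N A) := inferInstanceAs (AddCommGroup (Fin N → A))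

instance : AddCommGroup (ColVec N A) := inferInstanceAs (AddCommGroup (Fin N → A))

instance : Module A (RowVec N A) := inferInstanceAs (Module A (Fin N → A))

instance : Module Aᵐᵒᵖ (ColVec N A) := inferInstanceAs (Module Aᵐᵒᵖ (Fin N → A))

instance : Module (Matrix (Fin N) (Fin N) A)ᵐᵒᵖ (RowVec N A) where
  smul X v := v ᵥ* X.unop
  one_smul v := vecMul_one (α := A) v
  mul_smul X Y v := (vecMul_vecMul v Y.unop X.unop).symm
  smul_zero X := zero_vecMul X.unop
  smul_add X v w := add_vecMul X.unop v w
  add_smul X Y v := vecMul_add X.unop Y.unop v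
  zero_smul v := vecMul_zero v

instance : Module (Matrix (Fin N) (Fin N) A) (ColVec N A) where
  smul X v := X *ᵥ v
  one_smul v := one_mulVec (α := A) v
  mul_smul X Y v := (mulVec_mulVec v X Y).symm
  smul_zero X := mulVec_zero X
  smul_add X v w := mulVec_add X v w
  add_smul X Y v := add_mulVec X Y v
  zero_smul v := zero_mulVec v

instance : SMulCommClass A (Matrix (Fin N) (Fin N) A)ᵐᵒᵖ (RowVec N A) where
  smul_comm a X v := (smul_vecMul a v X.unop).symm

instance : SMulCommClass (Matrix (Fin N) (Fin N) A) Aᵐᵒᵖ (ColVec N A) where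
  smul_comm X a v := mulVec_smul X a v

/-- The row vector with a single nonzero entry `1`. -/
def RowVec.basis (i : Fin N) : RowVec N A := (Pi.single i 1 : Fin N → A)

/-- The column vector with a single nonzero entry. -/
def ColVec.single (i : Fin N) : A →+ ColVec N A :=
  (AddMonoidHom.single (fun _ : Fin N => A) i : A →+ (Fin N → A))

variable (N A) in
/-- The pairing of rows and columns. -/
def rowDotCol : BalancedTensor (Matrix (Fin N) (Fin N) A) (RowVec N A) (ColVec N A) →+ A :=
  BalancedTensor.lift
    (AddMonoidHom.mk' (fun v => AddMonoidHom.mk' (fun w => (v : Fin N → A) ⬝ᵥ w)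
      fun w w' => dotProduct_add (v : Fin N → A) w w')
      fun v v' => AddMonoidHom.ext fun w => add_dotProduct (v : Fin N → A) v' w)
    fun v X w => (dotProduct_mulVec (v : Fin N → A) X w).symm

/-- Over the matrix ring a pure tensor depends only on its dot product: write `v = e_o X` and move
`X` across to obtain `e_o ⊗ X w`. -/
theorem tmul_eq_basis_tmul_single (o : Fin N) (v : RowVec N A) (w : ColVec N A) :
    BalancedTensor.tmul (Matrix (Fin N) (Fin N) A) v w =
      BalancedTensor.tmul (Matrix (Fin N) (Fin N) A) (RowVec.basis o)
        (ColVec.single o ((v : Fin N → A) ⬝ᵥ w)) := by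
  -- `X` has row `o` equal to `v` and all other rows zero, so `e_o X = v`, and `X w` has the single
  -- entry `v ⬝ᵥ w` at `o`.
  let X : Matrix (Fin N) (Fin N) A := Matrix.of fun i j => if i = o then v j else 0
  have h1 : op X • (RowVec.basis o : RowVec N A) = v := by
    refine (single_one_vecMul o X).trans (funext fun j => ?_)
    simp [X, Matrix.row]
  have h2 : X • w = ColVec.single o ((v : Fin N → A) ⬝ᵥ w) := by
    change X *ᵥ (w : Fin N → A) = (Pi.single o ((v : Fin N → A) ⬝ᵥ w) : Fin N → A)
    funext i
    by_cases h : i = o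
    · subst h
      simp [X, mulVec, dotProduct]
    · simp [X, mulVec, dotProduct, h]
  rw [← h2, ← BalancedTensor.smul_tmul, h1]

/-- The isomorphism of `A`-bimodules between rows tensored with columns and `A`. -/
def rowDotColEquiv (o : Fin N) :
    BalancedTensor (Matrix (Fin N) (Fin N) A) (RowVec N A) (ColVec N A) ≃+ A :=
  AddMonoidHom.toAddEquiv (rowDotCol N A)
    ((BalancedTensor.tmulLeft (Matrix (Fin N) (Fin N) A) (ColVec N A) (RowVec.basis o)).comp
      (ColVec.single o))
    (BalancedTensor.hom_ext fun v w => (tmul_eq_basis_tmul_single o v w).symm)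
    (AddMonoidHom.ext fun a => by
      change (Pi.single o 1 : Fin N → A) ⬝ᵥ (Pi.single o a : Fin N → A) = a
      simp)

variable (N A) in
/-- The product of columns and rows. -/
def colMulRow : BalancedTensor A (ColVec N A) (RowVec N A) →+ Matrix (Fin N) (Fin N) A :=
  BalancedTensor.lift
    (AddMonoidHom.mk' (fun w => AddMonoidHom.mk' (fun v => vecMulVec (w : Fin N → A) v)
      fun v v' => vecMulVec_add (w : Fin N → A) v v')
      fun w w' => AddMonoidHom.ext fun v => add_vecMulVec (w : Fin N → A) w' v)
    fun w a v => by
      ext i j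
      exact mul_assoc (w i) a (v j)

/-- The rows of a matrix. -/
def rowOf (X : Matrix (Fin N) (Fin N) A) (i : Fin N) : RowVec N A := X i

variable (N A) in
/-- The decomposition of a matrix into its rows. -/
def rowDecomposition : Matrix (Fin N) (Fin N) A →+ BalancedTensor A (ColVec N A) (RowVec N A) :=
  AddMonoidHom.mk' (fun X => ∑ i, BalancedTensor.tmul A (ColVec.single i 1) (rowOf X i))
    fun X Y => by
      rw [← Finset.sum_add_distrib]
      exact Finset.sum_congr rfl fun i _ => BalancedTensor.tmul_add _ _ _

theorem eq_sum_op_smul_single (w : Fin N → A) :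
    w = ∑ i, op (w i) • (Pi.single i 1 : Fin N → A) := by
  funext j
  simp [Finset.sum_apply, Pi.single_apply]

theorem ColVec.eq_sum_single (w : ColVec N A) :
    w = ∑ i, op ((w : Fin N → A) i) • (ColVec.single i 1 : ColVec N A) :=
  eq_sum_op_smul_single (w : Fin N → A)

/-- The isomorphism of `M_N(A)`-bimodules between columns tensored with rows and `M_N(A)`. -/
def colMulRowEquiv : BalancedTensor A (ColVec N A) (RowVec N A) ≃+ Matrix (Fin N) (Fin N) A :=
  AddMonoidHom.toAddEquiv (colMulRow N A) (rowDecomposition N A)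
    (BalancedTensor.hom_ext fun w v => by
      -- Writing `w = ∑ e_i w_i` and moving `w_i` across gives `∑ e_i ⊗ w_i v`, and `w_i v` is row
      -- `i` of the product of `w` and `v`.
      have h : BalancedTensor.tmul A w v =
          ∑ i, BalancedTensor.tmul A (op ((w : Fin N → A) i) • (ColVec.single i 1 : ColVec N A)) v :=
        (congrArg (BalancedTensor.tmulRight A (ColVec N A) v) (ColVec.eq_sum_single w)).trans
          (map_sum _ _ _)
      refine Eq.trans ?_ h.symm
      change ∑ i, BalancedTensor.tmul A (ColVec.single i 1 : ColVec N A)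
        ((w : Fin N → A) i • v) = _
      exact Finset.sum_congr rfl fun i _ =>
        (BalancedTensor.smul_tmul ((w : Fin N → A) i) (ColVec.single i 1 : ColVec N A) v).symm)
    (AddMonoidHom.ext fun X => by
      refine Eq.trans (b := ∑ i, colMulRow N A (BalancedTensor.tmul A (ColVec.single i 1)
        (rowOf X i))) (map_sum (colMulRow N A)
          (fun i => BalancedTensor.tmul A (ColVec.single i 1) (rowOf X i)) Finset.univ) ?_
      change ∑ i, vecMulVec (Pi.single i 1 : Fin N → A) (X i) = X
      ext i j
      rw [Matrix.sum_apply]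
      simp [vecMulVec_apply, Pi.single_apply])

end Vectors

/-! ### Morita equivalence of the triple with its matrix triple. -/

namespace AlgTriple

section MatrixMorita

variable {k A B : Type*} [CommRing k] [Ring A] [CommRing B] [Algebra k A] [Algebra k B]
variable {N : ℕ}

variable (k B) in
/-- The isomorphism between `B` and the algebra of scalar matrices. -/
def scalarEquiv (o : Fin N) : B ≃ₐ[k] ScalarMatrices k B N :=
  AlgEquiv.ofBijective (toScalar k B N)
    -- Injectivity reads off the diagonal entry at `o`, so it needs matrices of positive size.
    ⟨Function.LeftInverse.injective (ofScalar_toScalar o), toScalar_surjective⟩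

/-- Centrality of `ε(b)` moves it from the left of each entry to the right. This gives the
compatibility with `η` on rows; the next lemma gives it on columns. -/
theorem smul_eq_vecMul_diagonal (T : AlgTriple k A B) (b : B) (v : Fin N → A) :
    T.ε b • v = Matrix.vecMul v (Matrix.diagonal fun _ => T.ε b) := by
  funext i
  rw [Matrix.vecMul_diagonal]
  exact T.comm b _

theorem op_smul_eq_diagonal_mulVec (T : AlgTriple k A B) (b : B) (v : Fin N → A) :
    op (T.ε b) • v = (Matrix.diagonal fun _ => T.ε b).mulVec v := by
  funext i
  rw [Matrix.mulVec_diagonal]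
  exact (T.comm b _).symm

theorem moritaEquivalent_matrix (T : AlgTriple k A B) (o : Fin N) : T.MoritaEquivalent (T.matrix N) :=
  ⟨{ P := RowVec N A
     Q := ColVec N A
     f := rowDotColEquiv o
     f_left := fun a z => by
      refine DFunLike.congr_fun (F := _ →+ _)
        (f := (rowDotCol N A).comp (BalancedTensor.leftAct a))
        (g := (AddMonoidHom.mulLeft a).comp (rowDotCol N A))
        (BalancedTensor.hom_ext fun v w => ?_) z
      exact smul_dotProduct a (v : Fin N → A) w
     f_right := fun a z => by
      refine DFunLike.congr_fun (F := _ →+ _)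
        (f := (rowDotCol N A).comp (BalancedTensor.rightAct a))
        (g := (AddMonoidHom.mulRight a).comp (rowDotCol N A))
        (BalancedTensor.hom_ext fun v w => ?_) z
      exact dotProduct_smul (op a) (v : Fin N → A) w
     g := colMulRowEquiv
     g_left := fun X z => by
      refine DFunLike.congr_fun (F := _ →+ _)
        (f := (colMulRow N A).comp (BalancedTensor.leftAct X))
        (g := (AddMonoidHom.mulLeft X).comp (colMulRow N A))
        (BalancedTensor.hom_ext fun w v => ?_) z
      exact (Matrix.mul_vecMulVec X (w : Fin N → A) v).symm
     g_right := fun X z => by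
      refine DFunLike.congr_fun (F := _ →+ _)
        (f := (colMulRow N A).comp (BalancedTensor.rightAct X))
        (g := (AddMonoidHom.mulRight X).comp (colMulRow N A))
        (BalancedTensor.hom_ext fun w v => ?_) z
      exact (Matrix.vecMulVec_mul (w : Fin N → A) v X).symm
     η := scalarEquiv k B o
     symm_P := fun α p => by
      change T.ε α • p = op ((T.matrix N).ε (toScalar k B N α)) • p
      rw [ε_toScalar]
      exact T.smul_eq_vecMul_diagonal α p
     symm_Q := fun α q => by
      change op (T.ε α) • q = (T.matrix N).ε (toScalar k B N α) • q
      rw [ε_toScalar]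
      exact T.op_smul_eq_diagonal_mulVec α q }⟩

end MatrixMorita

end AlgTriple

end
theorem mainTheorem2 {k A B : Type*} [Field k] [Ring A] [CommRing B] [Algebra k A] [Algebra k B]
    (T : AlgTriple k A B) (n : ℕ) (hn : 1 ≤ n) :
    T.MoritaEquivalent (T.matrix n) ∧
      ∀ (M : Type*) [AddCommGroup M] [Module k M] [Module A M] [Module Aᵐᵒᵖ M]
        [SMulCommClass A Aᵐᵒᵖ M] [IsScalarTower k A M] [IsScalarTower k Aᵐᵒᵖ M]
        (hM : T.IsSymmetric M) (i : ℕ),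
        Nonempty (T.homology M hM i ≃ₗ[k]
          (T.matrix n).homology (MatrixBimodule n M) (T.isSymmetric_matrix hM n) i) :=
  -- The distinguished index `o` is taken to be `0`, available because `n ≥ 1`.
  ⟨T.moritaEquivalent_matrix ⟨0, hn⟩, fun M _ _ _ _ _ _ _ hM i =>
    ⟨(T.homologyMatrixIso M ⟨0, hn⟩ hM i).toLinearEquiv⟩⟩
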